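/- **Theorem.** Let $\mathsf{PosComp}$ be the category of compact ordered spaces (compact topological spaces $X$ with a partial order $\le$ such that $\{(x,y)\mid x\le y\}$ is closed in $X\times X$) and monotone continuous maps. A *variety of algebras* is the category of all algebras, with all homomorphisms, for a given set of operation symbols of possibly infinite arity satisfying a given class of identities. Then $\mathsf{PosComp}^{\mathrm{op}}$ is equivalent to a variety of algebras. More precisely, let $\mathsf{MC}_\infty$ be the variety with binary operations $\oplus,\odot,\vee,\wedge$, a constant $\lambda$ for each $\lambda\in[0,1]$, one operation $\delta$ of countably infinite arity, and the following axioms, where $s\le t$ stands for $s\wedge t=s$ and $x\ominus\lambda:=x\odot(1-\lambda)$ for $\lambda\in[0,1]$: 1. $(\vee,\wedge,0,1)$ is a distributive bounded lattice; $(\oplus,0)$ is a commutative monoid with absorbing element $1$; $(\odot,1)$ is a commutative monoid with absorbing element $0$; $\oplus$ and $\odot$ distribute over $\vee$ and $\wedge$. 2. $(a\oplus b)\odot c\le a\oplus(b\odot c)$; and, for every $\lambda\in[0,1]$, $a\le(a\ominus\lambda)\oplus\lambda$ and $(a\oplus\lambda)\ominus\lambda\le a$. 3. For every $\lambda\in[0,1]$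 and all $n,m\ge 0$: $a\wedge(b\oplus(c\odot\lambda)\oplus\dots\oplus(c\odot\lambda))\le(a\odot(c\oplus\lambda)\odot\dots\odot(c\oplus\lambda))\vee b$, with $n$ copies of $c\odot\lambda$ and $m$ copies of $c\oplus\lambda$. 4. For all $\alpha,\beta\in[0,1]$ and $*\in\{\vee,\wedge,\oplus,\odot\}$: $\alpha*\beta=\gamma$, where $\gamma$ is the value of $\alpha*\beta$ in $[0,1]$, computed with $\alpha\vee\beta=\max\{\alpha,\beta\}$, $\alpha\wedge\beta=\min\{\alpha,\beta\}$, $\alpha\oplus\beta=\min\{\alpha+\beta,1\}$ and $\alpha\odot\beta=\max\{\alpha+\beta-1,0\}$. 5. $\delta(x,x,x,\dots)=x$; $\ \delta(x_0,x_1,\dots)\le\delta(x_0\vee y_0,x_1\vee y_1,\dots)$; $\ \delta(x\ominus\tfrac1{2^0},x\ominus\tfrac1{2^1},x\ominus\tfrac1{2^2},\dots)=x$; and, for every $n\ge0$, $\rho_n(x_0,\dots,x_n)\le\delta(x_0,x_1,\dots)\le\rho_n(x_0,\dots,x_n)\oplus\min\{\tfrac1{2^{n-1}},1\}$, where $\rho_0(x_0)=x_0$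 and $\rho_{n+1}(x_0,\dots,x_{n+1})=(x_0\vee\dots\vee x_{n+1})\wedge(\rho_n(x_0,\dots,x_n)\oplus\tfrac1{2^n})$. The interval $[0,1]$ is a compact ordered space with its usual order and topology, and an $\mathsf{MC}_\infty$-algebra with the operations of item 4, each constant interpreted as itself, and $\delta(x_0,x_1,\dots)=\lim_{n}\rho_n(x_0,\dots,x_n)$. For a compact ordered space $X$ let $\mathrm C(X)=\hom_{\mathsf{PosComp}}(X,[0,1])$ with pointwise operations. For an $\mathsf{MC}_\infty$-algebra $A$ let $\mathrm{Max}(A)=\hom_{\mathsf{MC}_\infty}(A,[0,1])$ with the pointwise order and the coarsest topology that makes all evaluations $x\mapsto x(a)$, $a\in A$, continuous. Then $\mathrm C$ and $\mathrm{Max}$, acting on morphisms by precomposition, are contravariant functors that form a dual equivalence between $\mathsf{PosComp}$ and $\mathsf{MC}_\infty$. Its natural isomorphisms are the evaluations $X\to\mathrm{Max}(\mathrm C(X))$, $x\mapsto(f\mapsto f(x))$, and $A\to\mathrm C(\mathrm{Max}(A))$, $a\mapsto(x\mapsto x(a))$, and they satisfy the triangle identities. -/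

import Mathlib

open CategoryTheory Opposite Filter Topology
open scoped unitInterval

universe u v

namespace PosCompDual

/-! ### Varieties of (possibly infinitary) algebras -/

/-- A signature: a set of operation symbols, each with an arbitrary set as its arity. -/
structure Signature where
  Op : Type
  arity : Op → Type

/-- Terms over a signature, with variables from `V`. -/
inductive Term (S : Signature) (V : Type) : Type
  | var (v : V) : Term S V
  | app (o : S.Op) (args : S.arity o → Term S V) : Term S V

/-- Value of a term, given an interpretation of the operation symbols on `A` and an
assignment of the variables. -/
def Term.eval {S : Signature} {V : Type} {A : Type*} (F : ∀ o : S.Op, (S.arity o → A) → A)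
    (v : V → A) : Term S V → A
  | .var i => v i
  | .app o args => F o (fun i => (args i).eval F v)

/-- A formal identity `lhs = rhs` between two terms in a set `Var` of variables. -/
structure Identity (S : Signature) where
  Var : Type
  lhs : Term S Var
  rhs : Term S Var

/-- The identity `e` holds in the algebra `(A, F)`: its two sides agree under every assignment. -/
def Identity.Holds {S : Signature} (e : Identity S) {A : Type*}
    (F : ∀ o : S.Op, (S.arity o → A) → A) : Prop :=
  ∀ v : e.Var → A, e.lhs.eval F v = e.rhs.eval F v

/-- The variety axiomatized by a class `T` of identities: its objects are all the algebras for the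
signature in which the identities of `T` hold. -/
structure Variety {S : Signature} (T : Set (Identity S)) : Type (u + 1) where
  carrier : Type u
  interp : ∀ o : S.Op, (S.arity o → carrier) → carrier
  holds : ∀ e ∈ T, e.Holds interp

/-- Homomorphisms: maps that preserve every operation. -/
@[ext]
structure Variety.Hom {S : Signature} {T : Set (Identity S)}
    (A : Variety.{u} T) (B : Variety.{v} T) where
  toFun : A.carrier → B.carrier
  map_interp : ∀ (o : S.Op) (x : S.arity o → A.carrier),
    toFun (A.interp o x) = B.interp o (fun i => toFun (x i))

instance {S : Signature} (T : Set (Identity S)) : Category (Variety.{u} T) where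
  Hom A B := Variety.Hom A B
  id A := ⟨id, fun _ _ => rfl⟩
  comp f g := ⟨fun a => g.toFun (f.toFun a), fun o x => by rw [f.map_interp, g.map_interp]⟩

/-! ### Compact ordered spaces -/

/-- A compact ordered space: a compact space with a partial order that is closed in the square. -/
structure PosComp : Type (u + 1) where
  carrier : Type u
  [top : TopologicalSpace carrier]
  [order : PartialOrder carrier]
  [compact : CompactSpace carrier]
  [closed : OrderClosedTopology carrier]

attribute [instance] PosComp.top PosComp.order PosComp.compact PosComp.closed

/-- The category of compact ordered spaces and monotone continuous maps. -/
instance : Category PosComp.{u} where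
  Hom X Y := X.carrier →Co Y.carrier
  id X := ContinuousOrderHom.id X.carrier
  comp f g := ContinuousOrderHom.comp g f

/-! ### The operations and the axioms -/

/-- The finitary operations `⊕`, `⊙`, `∨`, `∧` and the constants `λ ∈ [0,1]`. -/
class MCOps (A : Type*) where
  oplus : A → A → A
  odot : A → A → A
  join : A → A → A
  meet : A → A → A
  const : I → A

infixl:65 " ⊕ₘ " => MCOps.oplus
infixl:70 " ⊙ₘ " => MCOps.odot
infixl:60 " ∨ₘ " => MCOps.join
infixl:60 " ∧ₘ " => MCOps.meet

/-- The constant `1 / 2 ^ n` of `[0,1]`. -/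
noncomputable def halfPow (n : ℕ) : I :=
  ⟨1 / 2 ^ n, by positivity, by
    rw [div_le_one (by positivity)]; exact one_le_pow₀ (by norm_num)⟩

/-- `x₀ ∨ ... ∨ xₙ`. -/
def joins {A : Type*} [MCOps A] (x : ℕ → A) : ℕ → A
  | 0 => x 0
  | n + 1 => joins x n ∨ₘ x (n + 1)

/-- `ρ₀(x₀) = x₀` and
`ρₙ₊₁(x₀, ..., xₙ₊₁) = (x₀ ∨ ... ∨ xₙ₊₁) ∧ (ρₙ(x₀, ..., xₙ) ⊕ 1 / 2 ^ n)`. -/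
noncomputable def rho {A : Type*} [MCOps A] (x : ℕ → A) : ℕ → A
  | 0 => x 0
  | n + 1 => joins x (n + 1) ∧ₘ (rho x n ⊕ₘ MCOps.const (halfPow n))

/-- `x ⊖ λ = x ⊙ (1 - λ)`, for `λ` in `[0,1]`. -/
def ominus {A : Type*} [MCOps A] (x : A) (l : I) : A := x ⊙ₘ MCOps.const (unitInterval.symm l)

/-- The operation symbols. -/
inductive MCSymbol : Type
  | oplus | odot | join | meet
  | const (l : I)
  | delta

/-- The signature: four binary operations, a constant for each `λ ∈ [0,1]`, and one operation `δ`
of countably infinite arity. -/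
abbrev mcSignature : Signature where
  Op := MCSymbol
  arity
    | .oplus => Fin 2
    | .odot => Fin 2
    | .join => Fin 2
    | .meet => Fin 2
    | .const _ => Fin 0
    | .delta => ℕ

abbrev MCTerm (V : Type) : Type := Term mcSignature V

instance (V : Type) : MCOps (MCTerm V) where
  oplus s t := .app .oplus (![s, t] : Fin 2 → MCTerm V)
  odot s t := .app .odot (![s, t] : Fin 2 → MCTerm V)
  join s t := .app .join (![s, t] : Fin 2 → MCTerm V)
  meet s t := .app .meet (![s, t] : Fin 2 → MCTerm V)
  const l := .app (.const l) (![] : Fin 0 → MCTerm V)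

def delta {V : Type} (x : ℕ → MCTerm V) : MCTerm V := .app .delta x

/-- The identity `s = t`. -/
def eqn {V : Type} (s t : MCTerm V) : Identity mcSignature := ⟨V, s, t⟩

/-- The inequality `s ≤ t`, that is, the identity `s ∧ t = s`. -/
def leq {V : Type} (s t : MCTerm V) : Identity mcSignature := eqn (s ∧ₘ t) s

/-- The variables `a`, `b`, `c`. -/
abbrev va : MCTerm ℕ := .var 0
abbrev vb : MCTerm ℕ := .var 1
abbrev vc : MCTerm ℕ := .var 2

/-- The constants, as terms. -/
abbrev k (l : I) : MCTerm ℕ := MCOps.const l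

/-- The equational axioms of `MC_∞`. -/
inductive MCInftyAxiom : Identity mcSignature → Prop
  -- a distributive bounded lattice
  | join_comm : MCInftyAxiom (eqn (va ∨ₘ vb) (vb ∨ₘ va))
  | meet_comm : MCInftyAxiom (eqn (va ∧ₘ vb) (vb ∧ₘ va))
  | join_assoc : MCInftyAxiom (eqn (va ∨ₘ (vb ∨ₘ vc)) ((va ∨ₘ vb) ∨ₘ vc))
  | meet_assoc : MCInftyAxiom (eqn (va ∧ₘ (vb ∧ₘ vc)) ((va ∧ₘ vb) ∧ₘ vc))
  | join_absorb : MCInftyAxiom (eqn (va ∨ₘ (va ∧ₘ vb)) va)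
  | meet_absorb : MCInftyAxiom (eqn (va ∧ₘ (va ∨ₘ vb)) va)
  | join_zero : MCInftyAxiom (eqn (va ∨ₘ k 0) va)
  | meet_one : MCInftyAxiom (eqn (va ∧ₘ k 1) va)
  | join_distrib : MCInftyAxiom (eqn (va ∨ₘ (vb ∧ₘ vc)) ((va ∨ₘ vb) ∧ₘ (va ∨ₘ vc)))
  | meet_distrib : MCInftyAxiom (eqn (va ∧ₘ (vb ∨ₘ vc)) ((va ∧ₘ vb) ∨ₘ (va ∧ₘ vc)))
  -- `⊕` is a commutative monoid operation with unit 0 and absorbing element 1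
  | oplus_assoc : MCInftyAxiom (eqn ((va ⊕ₘ vb) ⊕ₘ vc) (va ⊕ₘ (vb ⊕ₘ vc)))
  | oplus_comm : MCInftyAxiom (eqn (va ⊕ₘ vb) (vb ⊕ₘ va))
  | oplus_zero : MCInftyAxiom (eqn (va ⊕ₘ k 0) va)
  | oplus_one : MCInftyAxiom (eqn (va ⊕ₘ k 1) (k 1))
  -- `⊙` is a commutative monoid operation with unit 1 and absorbing element 0
  | odot_assoc : MCInftyAxiom (eqn ((va ⊙ₘ vb) ⊙ₘ vc) (va ⊙ₘ (vb ⊙ₘ vc)))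
  | odot_comm : MCInftyAxiom (eqn (va ⊙ₘ vb) (vb ⊙ₘ va))
  | odot_one : MCInftyAxiom (eqn (va ⊙ₘ k 1) va)
  | odot_zero : MCInftyAxiom (eqn (va ⊙ₘ k 0) (k 0))
  -- `⊕` and `⊙` distribute over `∨` and `∧`
  | oplus_join : MCInftyAxiom (eqn ((va ∨ₘ vb) ⊕ₘ vc) ((va ⊕ₘ vc) ∨ₘ (vb ⊕ₘ vc)))
  | oplus_meet : MCInftyAxiom (eqn ((va ∧ₘ vb) ⊕ₘ vc) ((va ⊕ₘ vc) ∧ₘ (vb ⊕ₘ vc)))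
  | odot_join : MCInftyAxiom (eqn ((va ∨ₘ vb) ⊙ₘ vc) ((va ⊙ₘ vc) ∨ₘ (vb ⊙ₘ vc)))
  | odot_meet : MCInftyAxiom (eqn ((va ∧ₘ vb) ⊙ₘ vc) ((va ⊙ₘ vc) ∧ₘ (vb ⊙ₘ vc)))
  -- weak associativity
  | oplus_odot : MCInftyAxiom (leq ((va ⊕ₘ vb) ⊙ₘ vc) (va ⊕ₘ (vb ⊙ₘ vc)))
  | le_ominus_oplus (l : I) : MCInftyAxiom (leq va (ominus va l ⊕ₘ k l))
  | oplus_ominus_le (l : I) : MCInftyAxiom (leq (ominus (va ⊕ₘ k l) l) va)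
  -- `a ∧ (b ⊕ (c ⊙ λ) ⊕ ... ⊕ (c ⊙ λ)) ≤ (a ⊙ (c ⊕ λ) ⊙ ... ⊙ (c ⊕ λ)) ∨ b`,
  -- with `n`, respectively `m`, repetitions
  | interpolate (l : I) (n m : ℕ) : MCInftyAxiom
      (leq (va ∧ₘ ((fun t => t ⊕ₘ (vc ⊙ₘ k l))^[n] vb))
        (((fun t => t ⊙ₘ (vc ⊕ₘ k l))^[m] va) ∨ₘ vb))
  -- the constants are combined as in `[0,1]`
  | const_join (α β : I) : MCInftyAxiom (eqn (k α ∨ₘ k β) (k (max α β)))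
  | const_meet (α β : I) : MCInftyAxiom (eqn (k α ∧ₘ k β) (k (min α β)))
  | const_oplus (α β γ : I) (h : (γ : ℝ) = min ((α : ℝ) + β) 1) :
      MCInftyAxiom (eqn (k α ⊕ₘ k β) (k γ))
  | const_odot (α β γ : I) (h : (γ : ℝ) = max ((α : ℝ) + β - 1) 0) :
      MCInftyAxiom (eqn (k α ⊙ₘ k β) (k γ))
  -- the axioms for `δ`
  | delta_const : MCInftyAxiom (eqn (delta fun _ => va) va)
  | delta_join : MCInftyAxiom
      (leq (V := ℕ ⊕ ℕ) (delta fun n => .var (.inl n))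
        (delta fun n => .var (.inl n) ∨ₘ .var (.inr n)))
  | delta_ominus : MCInftyAxiom (eqn (delta fun n => ominus va (halfPow n)) va)
  | rho_le_delta (n : ℕ) : MCInftyAxiom (leq (V := ℕ) (rho .var n) (delta .var))
  -- `δ(x₀, x₁, ...) ≤ ρₙ(x₀, ..., xₙ) ⊕ 1 / 2 ^ (n - 1)`; the subtraction is truncated, so that
  -- for `n = 0` the right-hand side is `x₀ ⊕ 1`, the top element
  | delta_le_rho (n : ℕ) : MCInftyAxiom
      (leq (V := ℕ) (delta .var) (rho .var n ⊕ₘ MCOps.const (halfPow (n - 1))))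

/-- The equational theory of `MC_∞`. -/
def mcInfty : Set (Identity mcSignature) := {e | MCInftyAxiom e}

/-! ### The dualizing object `[0,1]` -/

/-- `a ⊕ b = min (a + b) 1`, `a ⊙ b = max (a + b - 1) 0`, suprema, infima and constants in
`[0,1]`. -/
noncomputable instance : MCOps I where
  oplus a b := ⟨min ((a : ℝ) + b) 1, le_min (add_nonneg a.2.1 b.2.1) zero_le_one, min_le_right _ _⟩
  odot a b := ⟨max ((a : ℝ) + b - 1) 0, le_max_right _ _,
    max_le (by linarith [a.2.2, b.2.2]) zero_le_one⟩
  join a b := max a b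
  meet a b := min a b
  const l := l

/-- `δ(x₀, x₁, ...) = lim ρₙ(x₀, ..., xₙ)` in `[0,1]`; the limit exists, see `tendsto_rho`. -/
noncomputable def deltaI (x : ℕ → I) : I := limUnder atTop (rho x)

/-- The standard interpretation of the operation symbols in `[0,1]`. -/
noncomputable def interpI : ∀ o : MCSymbol, (mcSignature.arity o → I) → I
  | .oplus => fun x : Fin 2 → I => x 0 ⊕ₘ x 1
  | .odot => fun x : Fin 2 → I => x 0 ⊙ₘ x 1
  | .join => fun x : Fin 2 → I => x 0 ∨ₘ x 1
  | .meet => fun x : Fin 2 → I => x 0 ∧ₘ x 1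
  | .const l => fun _ => l
  | .delta => fun x : ℕ → I => deltaI x

theorem coe_oplus (a b : I) : ((a ⊕ₘ b : I) : ℝ) = min ((a : ℝ) + b) 1 := rfl
theorem coe_odot (a b : I) : ((a ⊙ₘ b : I) : ℝ) = max ((a : ℝ) + b - 1) 0 := rfl
theorem join_def (a b : I) : (a ∨ₘ b : I) = max a b := rfl
theorem meet_def (a b : I) : (a ∧ₘ b : I) = min a b := rfl
theorem const_def (a : I) : (MCOps.const a : I) = a := rfl
theorem coe_join (a b : I) : ((a ∨ₘ b : I) : ℝ) = max (a : ℝ) b := by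
  rcases le_total a b with h | h <;> simp [join_def, h]
theorem coe_meet (a b : I) : ((a ∧ₘ b : I) : ℝ) = min (a : ℝ) b := by
  rcases le_total a b with h | h <;> simp [meet_def, h]
theorem coe_ominus (a b : I) : ((ominus a b : I) : ℝ) = max ((a : ℝ) - b) 0 := by
  simp only [ominus, coe_odot, const_def, unitInterval.coe_symm_eq]; congr 1; ring

theorem le_joins (x : ℕ → I) : ∀ n, x n ≤ joins x n
  | 0 => le_rfl
  | _ + 1 => le_max_right _ _

theorem rho_le_joins (x : ℕ → I) : ∀ n, rho x n ≤ joins x n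
  | 0 => le_rfl
  | _ + 1 => min_le_left _ _

theorem le_oplus (a b : I) : a ≤ a ⊕ₘ b := by
  rw [← Subtype.coe_le_coe, coe_oplus]
  exact le_min (by linarith [b.2.1]) a.2.2

theorem rho_le_succ (x : ℕ → I) (n : ℕ) : rho x n ≤ rho x (n + 1) :=
  le_min ((rho_le_joins x n).trans (le_max_left _ _)) (le_oplus _ _)

theorem rho_succ_le (x : ℕ → I) (n : ℕ) : ((rho x (n + 1) : I) : ℝ) ≤ (rho x n : I) + 1 / 2 ^ n := by
  have h : rho x (n + 1) ≤ rho x n ⊕ₘ MCOps.const (halfPow n) := min_le_right _ _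
  rw [← Subtype.coe_le_coe, coe_oplus] at h
  exact h.trans (min_le_left _ _)

theorem dist_rho_succ (x : ℕ → I) (n : ℕ) :
    dist (rho x n) (rho x (n + 1)) ≤ 2 / 2 / 2 ^ n := by
  have h1 : ((rho x n : I) : ℝ) ≤ (rho x (n + 1) : I) := rho_le_succ x n
  have h2 := rho_succ_le x n
  rw [Subtype.dist_eq, dist_comm, Real.dist_eq, abs_of_nonneg (by linarith)]
  rw [div_self two_ne_zero]
  linarith

theorem tendsto_rho (x : ℕ → I) : Tendsto (rho x) atTop (𝓝 (deltaI x)) :=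
  (cauchySeq_of_le_geometric_two (dist_rho_succ x)).tendsto_limUnder

theorem dist_rho_delta (x : ℕ → I) (n : ℕ) : dist (rho x n) (deltaI x) ≤ 2 / 2 ^ n :=
  dist_le_of_le_geometric_two_of_tendsto (dist_rho_succ x) (tendsto_rho x) n

theorem rho_le_deltaI (x : ℕ → I) (n : ℕ) : rho x n ≤ deltaI x :=
  (monotone_nat_of_le_succ (rho_le_succ x)).ge_of_tendsto (tendsto_rho x) n

theorem oplus_mono {a b c d : I} (h : a ≤ b) (h' : c ≤ d) : a ⊕ₘ c ≤ b ⊕ₘ d := by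
  rw [← Subtype.coe_le_coe] at *
  exact min_le_min (add_le_add h h') le_rfl

theorem odot_mono {a b c d : I} (h : a ≤ b) (h' : c ≤ d) : a ⊙ₘ c ≤ b ⊙ₘ d := by
  rw [← Subtype.coe_le_coe] at *
  exact max_le_max (by linarith) le_rfl

theorem joins_mono {x y : ℕ → I} (h : x ≤ y) : ∀ n, joins x n ≤ joins y n
  | 0 => h 0
  | n + 1 => max_le_max (joins_mono h n) (h _)

theorem rho_mono {x y : ℕ → I} (h : x ≤ y) : ∀ n, rho x n ≤ rho y n
  | 0 => h 0
  | n + 1 => min_le_min (joins_mono h _) (oplus_mono (rho_mono h n) le_rfl)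

theorem continuous_oplus : Continuous fun p : I × I => p.1 ⊕ₘ p.2 :=
  Continuous.subtype_mk (by fun_prop) _

theorem continuous_odot : Continuous fun p : I × I => p.1 ⊙ₘ p.2 :=
  Continuous.subtype_mk (by fun_prop) _

theorem continuous_joins : ∀ n, Continuous fun x : ℕ → I => joins x n
  | 0 => continuous_apply 0
  | n + 1 => (continuous_joins n).max (continuous_apply (n + 1))

theorem continuous_rho : ∀ n, Continuous fun x : ℕ → I => rho x n
  | 0 => continuous_apply 0
  | n + 1 => (continuous_joins (n + 1)).min
      (continuous_oplus.comp ((continuous_rho n).prodMk continuous_const))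

theorem deltaI_mono : Monotone deltaI := fun x y h =>
  le_of_tendsto_of_tendsto' (tendsto_rho x) (tendsto_rho y) (rho_mono h)

theorem continuous_deltaI : Continuous deltaI := by
  have h : TendstoUniformly (fun n (x : ℕ → I) => rho x n) deltaI atTop := by
    rw [Metric.tendstoUniformly_iff]
    intro ε hε
    have h2 : Tendsto (fun n : ℕ => (2 : ℝ) * (1 / 2) ^ n) atTop (𝓝 (2 * 0)) :=
      (tendsto_pow_atTop_nhds_zero_of_lt_one (by norm_num) (by norm_num)).const_mul 2
    rw [mul_zero] at h2
    filter_upwards [h2.eventually_lt_const hε] with n hn x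
    rw [dist_comm]
    refine (dist_rho_delta x n).trans_lt ?_
    rwa [one_div, inv_pow, ← div_eq_mul_inv] at hn
  exact h.continuous (Frequently.of_forall continuous_rho)

theorem interpI_mono (o : MCSymbol) : Monotone (interpI o) := by
  intro x y h
  cases o with
  | oplus => exact oplus_mono (h (0 : Fin 2)) (h (1 : Fin 2))
  | odot => exact odot_mono (h (0 : Fin 2)) (h (1 : Fin 2))
  | join => exact max_le_max (h (0 : Fin 2)) (h (1 : Fin 2))
  | meet => exact min_le_min (h (0 : Fin 2)) (h (1 : Fin 2))
  | const l => exact le_rfl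
  | delta => exact deltaI_mono h

theorem continuous_interpI (o : MCSymbol) : Continuous (interpI o) := by
  have h0 : Continuous fun x : Fin 2 → I => x 0 := continuous_apply 0
  have h1 : Continuous fun x : Fin 2 → I => x 1 := continuous_apply 1
  cases o with
  | oplus => exact continuous_oplus.comp (h0.prodMk h1)
  | odot => exact continuous_odot.comp (h0.prodMk h1)
  | join => exact h0.max h1
  | meet => exact h0.min h1
  | const l => exact continuous_const
  | delta => exact continuous_deltaI

section eval

variable {V : Type} (v : V → I)

theorem eval_oplus (s t : MCTerm V) :
    (s ⊕ₘ t).eval interpI v = s.eval interpI v ⊕ₘ t.eval interpI v := rfl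
theorem eval_odot (s t : MCTerm V) :
    (s ⊙ₘ t).eval interpI v = s.eval interpI v ⊙ₘ t.eval interpI v := rfl
theorem eval_join (s t : MCTerm V) :
    (s ∨ₘ t).eval interpI v = (s.eval interpI v ∨ₘ t.eval interpI v) := rfl
theorem eval_meet (s t : MCTerm V) :
    (s ∧ₘ t).eval interpI v = (s.eval interpI v ∧ₘ t.eval interpI v) := rfl
theorem eval_const (l : I) : (MCOps.const l : MCTerm V).eval interpI v = l := rfl
theorem eval_var (i : V) : (Term.var i : MCTerm V).eval interpI v = v i := rfl
theorem eval_ominus (s : MCTerm V) (l : I) :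
    (ominus s l).eval interpI v = ominus (s.eval interpI v) l := rfl
theorem eval_delta (x : ℕ → MCTerm V) :
    (delta x).eval interpI v = deltaI fun n => (x n).eval interpI v := rfl
theorem eval_joins (x : ℕ → MCTerm V) : ∀ n,
    (joins x n).eval interpI v = joins (fun n => (x n).eval interpI v) n
  | 0 => rfl
  | n + 1 => by simp only [joins, eval_join, eval_joins x n]
theorem eval_rho (x : ℕ → MCTerm V) : ∀ n,
    (rho x n).eval interpI v = rho (fun n => (x n).eval interpI v) n
  | 0 => rfl
  | n + 1 => by
    simp only [rho, eval_meet, eval_oplus, eval_joins, eval_rho x n, eval_const, const_def]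

end eval

/-- `δ` computes the limit of a sequence with `xₙ ≤ xₙ₊₁ ≤ xₙ ⊕ 1 / 2 ^ n`. -/
theorem deltaI_eq {x : ℕ → I} {a : I} (h0 : ∀ n, x n ≤ x (n + 1))
    (h1 : ∀ n, x (n + 1) ≤ x n ⊕ₘ halfPow n) (h : Tendsto x atTop (𝓝 a)) : deltaI x = a := by
  have hj : ∀ n, joins x n = x n := by
    intro n
    induction n with
    | zero => rfl
    | succ n ih => simp only [joins, ih, join_def]; exact max_eq_right (h0 n)
  have hr : rho x = x := by
    funext n
    induction n with
    | zero => rfl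
    | succ n ih => simp only [rho, ih, hj, meet_def]; exact min_eq_left (h1 n)
  exact tendsto_nhds_unique (tendsto_rho x) (by rw [hr]; exact h)

theorem interpI_holds (e : Identity mcSignature) (he : e ∈ mcInfty) : e.Holds interpI := by
  have red : ∀ {V : Type} {s t : MCTerm V},
      (∀ v : V → I, s.eval interpI v = t.eval interpI v) → (eqn s t).Holds interpI := fun h => h
  have redle : ∀ {V : Type} {s t : MCTerm V},
      (∀ v : V → I, s.eval interpI v ≤ t.eval interpI v) → (leq s t).Holds interpI :=
    fun h v => min_eq_left (h v)
  cases he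
  case delta_const =>
    refine red fun v => ?_
    simp only [eval_delta, eval_var]
    exact deltaI_eq (fun _ => le_rfl) (fun _ => le_oplus _ _) tendsto_const_nhds
  case delta_join =>
    refine redle fun v => ?_
    simp only [eval_delta, eval_var, eval_join, join_def]
    exact deltaI_mono fun n => le_max_left _ _
  case delta_ominus =>
    refine red fun v => ?_
    simp only [eval_delta, eval_var, eval_ominus]
    have hc : ∀ n, (halfPow n : ℝ) = 1 / 2 ^ n := fun n => rfl
    have hs : ∀ n, (halfPow n : ℝ) = 2 * halfPow (n + 1) := fun n => by
      rw [hc, hc, pow_succ]; field_simp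
    have hv := (v 0).2
    refine deltaI_eq (fun n => ?_) (fun n => ?_) ?_
    · rw [← Subtype.coe_le_coe, coe_ominus, coe_ominus, hs n]
      exact max_le_max (by linarith [(halfPow (n + 1)).2.1]) le_rfl
    · rw [← Subtype.coe_le_coe, coe_oplus, coe_ominus, coe_ominus]
      have h1 := (halfPow n).2.1
      have h2 := (halfPow (n + 1)).2.1
      have h3 := le_max_left ((v 0 : ℝ) - halfPow n) 0
      have h4 := le_max_right ((v 0 : ℝ) - halfPow n) 0
      exact max_le (le_min (by linarith) (by linarith [hv.2])) (le_min (by linarith) zero_le_one)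
    · rw [tendsto_subtype_rng]
      simp only [coe_ominus, hc]
      have h2 : Tendsto (fun n : ℕ => (1 : ℝ) / 2 ^ n) atTop (𝓝 0) := by
        simpa using tendsto_pow_atTop_nhds_zero_of_lt_one (r := (1 / 2 : ℝ)) (by norm_num)
          (by norm_num)
      have h3 := (h2.const_sub (v 0 : ℝ)).max (tendsto_const_nhds (x := (0 : ℝ)))
      rwa [sub_zero, max_eq_left hv.1] at h3
  case rho_le_delta n =>
    refine redle fun v => ?_
    simp only [eval_delta, eval_var, eval_rho]
    exact rho_le_deltaI _ _
  case delta_le_rho n =>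
    refine redle fun v => ?_
    simp only [eval_delta, eval_var, eval_rho, eval_oplus, eval_const]
    rw [← Subtype.coe_le_coe, coe_oplus]
    refine le_min ?_ (deltaI _).2.2
    have hd := dist_rho_delta (fun i => v i) n
    rw [Subtype.dist_eq, dist_comm, Real.dist_eq] at hd
    have hd' := (le_abs_self _).trans hd
    cases n with
    | zero =>
      have h1 : ((halfPow (0 - 1) : I) : ℝ) = 1 := by norm_num [halfPow]
      rw [h1]
      linarith [(deltaI fun i => v i).2.2, (rho (fun i => v i) 0).2.1]
    | succ n =>
      have h1 : ((halfPow (n + 1 - 1) : I) : ℝ) = 2 / 2 ^ (n + 1) := by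
        simp only [halfPow, Nat.add_sub_cancel, pow_succ]; field_simp
      rw [h1]
      linarith
  case interpolate l n m =>
    refine redle fun v => ?_
    have e1 : ∀ (n : ℕ) (t u : MCTerm ℕ), ((fun t => t ⊕ₘ u)^[n] t).eval interpI v =
        (fun a => a ⊕ₘ u.eval interpI v)^[n] (t.eval interpI v) := by
      intro n t u
      induction n generalizing t with
      | zero => rfl
      | succ n ih => rw [Function.iterate_succ_apply, ih]; rfl
    have e2 : ∀ (n : ℕ) (t u : MCTerm ℕ), ((fun t => t ⊙ₘ u)^[n] t).eval interpI v =
        (fun a => a ⊙ₘ u.eval interpI v)^[n] (t.eval interpI v) := by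
      intro n t u
      induction n generalizing t with
      | zero => rfl
      | succ n ih => rw [Function.iterate_succ_apply, ih]; rfl
    simp only [eval_meet, eval_join, e1, e2, eval_oplus, eval_odot, eval_const, eval_var,
      meet_def, join_def]
    rcases le_total ((v 2 : ℝ) + l) 1 with h | h
    · have h0 : (v 2 ⊙ₘ l : I) = 0 := Subtype.ext (by
        rw [coe_odot]; exact max_eq_right (by linarith))
      have h1 : (fun a : I => a ⊕ₘ (v 2 ⊙ₘ l)) = id := funext fun a => Subtype.ext (by
        rw [coe_oplus, h0]; simp [a.2.2])
      rw [h1, Function.iterate_id]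
      exact (min_le_right _ _).trans (le_max_right _ _)
    · have h0 : (v 2 ⊕ₘ l : I) = 1 := Subtype.ext (by
        rw [coe_oplus]; exact min_eq_right h)
      have h1 : (fun a : I => a ⊙ₘ (v 2 ⊕ₘ l)) = id := funext fun a => Subtype.ext (by
        rw [coe_odot, h0]; simp [a.2.1])
      rw [h1, Function.iterate_id]
      exact (min_le_left _ _).trans (le_max_left _ _)
  case const_join α β => exact red fun v => rfl
  case const_meet α β => exact red fun v => rfl
  case const_oplus α β γ h =>
    exact red fun v => Subtype.ext (by simpa [eval_oplus, eval_const, coe_oplus] using h.symm)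
  case const_odot α β γ h =>
    exact red fun v => Subtype.ext (by simpa [eval_odot, eval_const, coe_odot] using h.symm)
  case oplus_odot =>
    refine redle fun v => ?_
    have := (v 0).2; have := (v 1).2; have := (v 2).2
    simp only [eval_oplus, eval_odot, eval_var, ← Subtype.coe_le_coe, coe_oplus, coe_odot]
    grind
  case le_ominus_oplus l =>
    refine redle fun v => ?_
    have := (v 0).2; have := l.2
    simp only [eval_oplus, eval_ominus, eval_const, eval_var, ← Subtype.coe_le_coe, coe_oplus,
      coe_ominus]
    grind
  case oplus_ominus_le l =>
    refine redle fun v => ?_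
    have := (v 0).2; have := l.2
    simp only [eval_oplus, eval_ominus, eval_const, eval_var, ← Subtype.coe_le_coe, coe_oplus,
      coe_ominus]
    grind
  all_goals
    refine red fun v => Subtype.ext ?_
    have h0 := (v (0 : ℕ)).2
    have h1 := (v (1 : ℕ)).2
    have h2 := (v (2 : ℕ)).2
    simp only [eval_oplus, eval_odot, eval_join, eval_meet, eval_const, eval_var, coe_oplus,
      coe_odot, coe_join, coe_meet, Set.Icc.coe_zero, Set.Icc.coe_one]
    grind

/-- The algebra `[0,1]`. -/
noncomputable def algI : Variety.{0} mcInfty := ⟨I, interpI, interpI_holds⟩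

/-! ### The two contravariant functors `hom(-, [0,1])` -/

/-- The pointwise operations on the monotone continuous maps `X → [0,1]`. -/
noncomputable def contInterp (X : PosComp.{u}) (o : MCSymbol)
    (f : mcSignature.arity o → (X.carrier →Co I)) : X.carrier →Co I where
  toFun x := interpI o fun i => f i x
  monotone' _ _ h := interpI_mono o fun i => (f i).monotone' h
  continuous_toFun := (continuous_interpI o).comp
    (continuous_pi fun i => (f i).continuous_toFun)

/-- The algebra `C(X)` of monotone continuous maps `X → [0,1]`, with pointwise operations. -/
noncomputable def contAlg (X : PosComp.{u}) : Variety.{u} mcInfty where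
  carrier := X.carrier →Co I
  interp := contInterp X
  holds e he v := by
    have key : ∀ (t : MCTerm e.Var) (x : X.carrier),
        (t.eval (contInterp X) v) x = t.eval interpI fun i => v i x := by
      intro t x
      induction t with
      | var i => rfl
      | app o args ih => exact congrArg (interpI o) (funext ih)
    refine ContinuousOrderHom.ext fun x => ?_
    rw [key, key]
    exact interpI_holds e he _

/-- The contravariant functor `C = hom(-, [0,1])` from compact ordered spaces to algebras; it acts
on maps by precomposition. -/
noncomputable def contFunctor : PosComp.{u}ᵒᵖ ⥤ Variety.{u} mcInfty where
  obj X := contAlg X.unop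
  map {X Y} g :=
    { toFun := fun f : X.unop.carrier →Co I =>
        f.comp (show Y.unop.carrier →Co X.unop.carrier from g.unop)
      map_interp := fun _ _ => rfl }

section Max

variable (A : Variety.{u} mcInfty)

/-- A homomorphism `A → [0,1]` as an element of the power `[0,1]^A`. -/
def homVal (x : Variety.Hom A algI) : A.carrier → I := x.toFun

/-- Homomorphisms `A → [0,1]` are ordered pointwise. -/
instance : PartialOrder (Variety.Hom A algI) :=
  PartialOrder.lift (homVal A) fun _ _ => Variety.Hom.ext

/-- The coarsest topology for which all the evaluations `x ↦ x a`, for `a` in `A`, are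
continuous. -/
instance : TopologicalSpace (Variety.Hom A algI) :=
  TopologicalSpace.induced (homVal A) Pi.topologicalSpace

theorem isInducing_homVal : IsInducing (homVal A) := ⟨rfl⟩

instance : CompactSpace (Variety.Hom A algI) := by
  have hr : Set.range (homVal A) =
      {x : A.carrier → I | ∀ (o : MCSymbol) (a : mcSignature.arity o → A.carrier),
        x (A.interp o a) = interpI o fun i => x (a i)} := by
    ext x
    exact ⟨fun ⟨y, hy⟩ => hy ▸ y.map_interp, fun h => ⟨⟨x, h⟩, rfl⟩⟩
  refine isCompact_univ_iff.mp ((isInducing_homVal A).isCompact_iff.mpr ?_)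
  rw [Set.image_univ, hr]
  refine IsClosed.isCompact ?_
  simp only [Set.ofPred_forall]
  refine isClosed_iInter fun o => isClosed_iInter fun a => isClosed_eq (continuous_apply _) ?_
  exact (continuous_interpI o).comp (continuous_pi fun i => continuous_apply (a i))

instance : OrderClosedTopology (Variety.Hom A algI) where
  isClosed_le' := by
    have h := (isInducing_homVal A).continuous
    exact isClosed_le (f := fun p : Variety.Hom A algI × Variety.Hom A algI => homVal A p.1)
      (h.comp continuous_fst) (h.comp continuous_snd)

/-- The compact ordered space `Max(A)` of homomorphisms `A → [0,1]`. -/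
noncomputable def maxSpace : PosComp.{u} := ⟨Variety.Hom A algI⟩

end Max

/-- The contravariant functor `Max = hom(-, [0,1])` from algebras to compact ordered spaces; it
acts on homomorphisms by precomposition. -/
noncomputable def maxFunctor : (Variety.{u} mcInfty)ᵒᵖ ⥤ PosComp.{u} where
  obj A := maxSpace A.unop
  map {A B} g :=
    { toFun := fun x : Variety.Hom A.unop algI =>
        (⟨fun b => x.toFun (g.unop.toFun b), fun o b => by
          rw [g.unop.map_interp, x.map_interp]⟩ : Variety.Hom B.unop algI)
      monotone' := fun _ _ h b => h (g.unop.toFun b)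
      continuous_toFun := (isInducing_homVal B.unop).continuous_iff.mpr <|
        continuous_pi fun b =>
          (continuous_apply (g.unop.toFun b)).comp (isInducing_homVal A.unop).continuous }

/-- The evaluation `η : X → Max(C(X))`, `x ↦ (f ↦ f x)`. -/
noncomputable def evalPoint (X : PosComp.{u}) : X ⟶ maxFunctor.obj (op (contFunctor.obj (op X))) :=
  show X.carrier →Co Variety.Hom (contAlg X) algI from
  { toFun := fun x => ⟨fun f : X.carrier →Co I => f x, fun _ _ => rfl⟩
    monotone' := fun _ _ h (f : X.carrier →Co I) => f.monotone' h
    continuous_toFun := (isInducing_homVal _).continuous_iff.mpr <|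
      continuous_pi fun f : X.carrier →Co I => f.continuous_toFun }

/-- The evaluation `ε : A → C(Max(A))`, `a ↦ (x ↦ x a)`. -/
noncomputable def evalElement (A : Variety.{u} mcInfty) :
    A ⟶ contFunctor.obj (op (maxFunctor.obj (op A))) :=
  show Variety.Hom A (contAlg (maxSpace A)) from
  { toFun := fun a => show Variety.Hom A algI →Co I from
      { toFun := fun x => x.toFun a
        monotone' := fun _ _ h => h a
        continuous_toFun := (continuous_apply a).comp (isInducing_homVal A).continuous }
    map_interp := fun o a => ContinuousOrderHom.ext fun x : Variety.Hom A algI =>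
      x.map_interp o a }

end PosCompDual

open PosCompDual

/-!
The functors `C` and `Max` are both `hom(-, [0,1])`, and the evaluations satisfy the triangle
identities by computation, so the theorem amounts to both evaluations being isomorphisms.

*Evaluation at points.* Monotone continuous functions to `[0,1]` detect the order of a compact
ordered space (`exists_continuousOrderHom_lt`): this is Urysohn's lemma carried out with open lower
sets, available since the lower closure of a closed set is closed. A homomorphism `C(X) → [0,1]` is
the evaluation at a point by compactness (`exists_eq_pointHom`): if it differed from every
evaluation, then finitely many functions that witness this could be combined into an inequality of
`C(X)` that the homomorphism violates. In both this step and the ordered Stone–Weierstrass theorem,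
a function that tells two homomorphisms apart is first stretched, with truncations and multiples,
to one that takes the values `0` and `1` (`exists_homVal_eq_one_eq_zero`).

*Evaluation at elements, injectivity.* If `a ≰ b` in an algebra `A`, the axioms for `δ` give
`a ⊖ 2⁻ⁿ ≰ b` for some `n` (`le_of_forall_ominus_le`). By Zorn's lemma there is a preorder `R` that
extends the order of `A`, is compatible with the finitary operations, and is maximal for not
relating `a ⊖ 2⁻ⁿ` to `b`. The interpolation axiom says that the preorder obtained from `R` by
adding `c ⊙ l ≤ 0` and the one obtained by adding `1 ≤ c ⊕ l` have no more in common than `R`, so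
one of them is `R`: every element is `R`-comparable to every constant
(`exists_isCompatible_comparable`). Each element thus defines a cut of `[0,1]`; sending it to the
corresponding real number is a homomorphism, and it separates `a` from `b` (`exists_hom_lt`).

*Evaluation at elements, surjectivity.* By an ordered version of the Stone–Weierstrass theorem,
evaluations are uniformly dense among the monotone continuous functions on `Max(A)`
(`exists_abs_homVal_sub_lt`), and `δ` turns a suitable sequence of approximations into an exact
preimage (`exists_homVal_eq`).
-/

namespace PosCompDual

/-! ### The algebraic laws -/

section Laws

instance (A : Variety.{u} mcInfty) : MCOps A.carrier where
  oplus a b := A.interp .oplus (![a, b] : Fin 2 → A.carrier)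
  odot a b := A.interp .odot (![a, b] : Fin 2 → A.carrier)
  join a b := A.interp .join (![a, b] : Fin 2 → A.carrier)
  meet a b := A.interp .meet (![a, b] : Fin 2 → A.carrier)
  const l := A.interp (.const l) (![] : Fin 0 → A.carrier)

instance (A : Variety.{u} mcInfty) : Max A.carrier := ⟨MCOps.join⟩

instance (A : Variety.{u} mcInfty) : Min A.carrier := ⟨MCOps.meet⟩

/-- The operation `δ` of an algebra. -/
def deltaOp {A : Variety.{u} mcInfty} (x : ℕ → A.carrier) : A.carrier := A.interp .delta x

variable {A : Variety.{u} mcInfty}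

theorem join_eq_sup (a b : A.carrier) : (a ∨ₘ b) = a ⊔ b := rfl
theorem meet_eq_inf (a b : A.carrier) : (a ∧ₘ b) = a ⊓ b := rfl

theorem interp_oplus (x : Fin 2 → A.carrier) : A.interp .oplus x = x 0 ⊕ₘ x 1 :=
  congrArg (A.interp .oplus) (List.ofFn_inj.mp rfl : x = ![x 0, x 1])

theorem interp_odot (x : Fin 2 → A.carrier) : A.interp .odot x = x 0 ⊙ₘ x 1 :=
  congrArg (A.interp .odot) (List.ofFn_inj.mp rfl : x = ![x 0, x 1])

theorem interp_join (x : Fin 2 → A.carrier) : A.interp .join x = x 0 ⊔ x 1 :=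
  congrArg (A.interp .join) (List.ofFn_inj.mp rfl : x = ![x 0, x 1])

theorem interp_meet (x : Fin 2 → A.carrier) : A.interp .meet x = x 0 ⊓ x 1 :=
  congrArg (A.interp .meet) (List.ofFn_inj.mp rfl : x = ![x 0, x 1])

theorem interp_const (l : I) (x : Fin 0 → A.carrier) : A.interp (.const l) x = MCOps.const l :=
  congrArg (A.interp (.const l)) (Subsingleton.elim x ![])

section TermValue

variable {V : Type} (v : V → A.carrier)

theorem value_oplus (s t : MCTerm V) :
    (s ⊕ₘ t).eval A.interp v = s.eval A.interp v ⊕ₘ t.eval A.interp v := interp_oplus _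
theorem value_odot (s t : MCTerm V) :
    (s ⊙ₘ t).eval A.interp v = s.eval A.interp v ⊙ₘ t.eval A.interp v := interp_odot _
theorem value_join (s t : MCTerm V) :
    (s ∨ₘ t).eval A.interp v = s.eval A.interp v ⊔ t.eval A.interp v := interp_join _
theorem value_meet (s t : MCTerm V) :
    (s ∧ₘ t).eval A.interp v = s.eval A.interp v ⊓ t.eval A.interp v := interp_meet _
theorem value_const (l : I) : (MCOps.const l : MCTerm V).eval A.interp v = MCOps.const l :=
  interp_const l _
theorem value_var (i : V) : (Term.var i : MCTerm V).eval A.interp v = v i := rfl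
theorem value_ominus (s : MCTerm V) (l : I) :
    (ominus s l).eval A.interp v = ominus (s.eval A.interp v) l := by
  simp only [ominus, value_odot, value_const]
theorem value_delta (x : ℕ → MCTerm V) :
    (delta x).eval A.interp v = deltaOp fun n => (x n).eval A.interp v := rfl
theorem value_joins (x : ℕ → MCTerm V) (n : ℕ) :
    (joins x n).eval A.interp v = joins (fun n => (x n).eval A.interp v) n := by
  induction n with
  | zero => rfl
  | succ n ih => simp only [joins, value_join, ih, join_eq_sup]
theorem value_rho (x : ℕ → MCTerm V) (n : ℕ) :
    (rho x n).eval A.interp v = rho (fun n => (x n).eval A.interp v) n := by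
  induction n with
  | zero => rfl
  | succ n ih => simp only [rho, value_meet, meet_eq_inf, value_oplus, value_joins, ih, value_const]
theorem value_iterate_oplus (n : ℕ) (t u : MCTerm V) :
    ((fun t => t ⊕ₘ u)^[n] t).eval A.interp v =
      (fun a => a ⊕ₘ u.eval A.interp v)^[n] (t.eval A.interp v) := by
  induction n generalizing t with
  | zero => rfl
  | succ n ih => rw [Function.iterate_succ_apply, ih, value_oplus, Function.iterate_succ_apply]
theorem value_iterate_odot (n : ℕ) (t u : MCTerm V) :
    ((fun t => t ⊙ₘ u)^[n] t).eval A.interp v =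
      (fun a => a ⊙ₘ u.eval A.interp v)^[n] (t.eval A.interp v) := by
  induction n generalizing t with
  | zero => rfl
  | succ n ih => rw [Function.iterate_succ_apply, ih, value_odot, Function.iterate_succ_apply]

theorem value_eq {s t : MCTerm V} (h : MCInftyAxiom (eqn s t)) :
    s.eval A.interp v = t.eval A.interp v := A.holds _ h v

theorem value_meet_eq {s t : MCTerm V} (h : MCInftyAxiom (leq s t)) :
    s.eval A.interp v ⊓ t.eval A.interp v = s.eval A.interp v :=
  (value_meet v s t).symm.trans (A.holds _ h v)

end TermValue

/-- The assignment of `a`, `b`, `c` to the variables `va`, `vb`, `vc`. -/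
def assign (a b c : A.carrier) : ℕ → A.carrier
  | 0 => a
  | 1 => b
  | _ => c

variable (a b c : A.carrier) (l m : I)

theorem value_va : va.eval A.interp (assign a b c) = a := rfl
theorem value_vb : vb.eval A.interp (assign a b c) = b := rfl
theorem value_vc : vc.eval A.interp (assign a b c) = c := rfl

/-- The lattice order of an algebra. -/
instance (A : Variety.{u} mcInfty) : DistribLattice A.carrier where
  __ := Lattice.mk' (α := A.carrier)
    (fun a b => by
      simpa only [value_join, value_va, value_vb, value_vc] using
        value_eq (assign a b a) .join_comm)
    (fun a b c => by
      simpa only [value_join, value_va, value_vb, value_vc] using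
        (value_eq (assign a b c) .join_assoc).symm)
    (fun a b => by
      simpa only [value_meet, value_va, value_vb, value_vc] using
        value_eq (assign a b a) .meet_comm)
    (fun a b c => by
      simpa only [value_meet, value_va, value_vb, value_vc] using
        (value_eq (assign a b c) .meet_assoc).symm)
    (fun a b => by
      simpa only [value_join, value_meet, value_va, value_vb, value_vc] using
        value_eq (assign a b a) .join_absorb)
    (fun a b => by
      simpa only [value_join, value_meet, value_va, value_vb, value_vc] using
        value_eq (assign a b a) .meet_absorb)
  le_sup_inf a b c := by
    simpa only [value_join, value_meet, value_va, value_vb, value_vc] using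
      (value_eq (assign a b c) .join_distrib).ge

theorem value_le {V : Type} (v : V → A.carrier) {s t : MCTerm V} (h : MCInftyAxiom (leq s t)) :
    s.eval A.interp v ≤ t.eval A.interp v :=
  inf_eq_left.mp (value_meet_eq v h)

theorem const_zero_le : MCOps.const 0 ≤ a := by
  have h := value_eq (assign a a a) .join_zero
  simp only [value_join, value_va, value_const] at h
  exact sup_eq_left.mp h

theorem le_const_one : a ≤ MCOps.const 1 := by
  have h := value_eq (assign a a a) .meet_one
  simp only [value_meet, value_va, value_const] at h
  exact inf_eq_left.mp h

theorem oplus_comm' : a ⊕ₘ b = b ⊕ₘ a := by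
  simpa only [value_oplus, value_va, value_vb, value_vc] using value_eq (assign a b a) .oplus_comm

theorem oplus_assoc' : a ⊕ₘ b ⊕ₘ c = a ⊕ₘ (b ⊕ₘ c) := by
  simpa only [value_oplus, value_va, value_vb, value_vc] using value_eq (assign a b c) .oplus_assoc

theorem oplus_const_zero : a ⊕ₘ MCOps.const 0 = a := by
  simpa only [value_oplus, value_va, value_vb, value_vc, value_const] using
    value_eq (assign a a a) .oplus_zero

theorem odot_comm' : a ⊙ₘ b = b ⊙ₘ a := by
  simpa only [value_odot, value_va, value_vb, value_vc] using value_eq (assign a b a) .odot_comm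

theorem odot_assoc' : a ⊙ₘ b ⊙ₘ c = a ⊙ₘ (b ⊙ₘ c) := by
  simpa only [value_odot, value_va, value_vb, value_vc] using value_eq (assign a b c) .odot_assoc

theorem odot_const_one : a ⊙ₘ MCOps.const 1 = a := by
  simpa only [value_odot, value_va, value_vb, value_vc, value_const] using
    value_eq (assign a a a) .odot_one

theorem sup_oplus : (a ⊔ b) ⊕ₘ c = (a ⊕ₘ c) ⊔ (b ⊕ₘ c) := by
  simpa only [value_oplus, value_join, value_va, value_vb, value_vc] using
    value_eq (assign a b c) .oplus_join

theorem inf_oplus : (a ⊓ b) ⊕ₘ c = (a ⊕ₘ c) ⊓ (b ⊕ₘ c) := by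
  simpa only [value_oplus, value_meet, value_va, value_vb, value_vc] using
    value_eq (assign a b c) .oplus_meet

theorem sup_odot : (a ⊔ b) ⊙ₘ c = (a ⊙ₘ c) ⊔ (b ⊙ₘ c) := by
  simpa only [value_odot, value_join, value_va, value_vb, value_vc] using
    value_eq (assign a b c) .odot_join

theorem inf_odot : (a ⊓ b) ⊙ₘ c = (a ⊙ₘ c) ⊓ (b ⊙ₘ c) := by
  simpa only [value_odot, value_meet, value_va, value_vb, value_vc] using
    value_eq (assign a b c) .odot_meet

theorem oplus_odot_le : (a ⊕ₘ b) ⊙ₘ c ≤ a ⊕ₘ (b ⊙ₘ c) := by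
  simpa only [value_oplus, value_odot, value_va, value_vb, value_vc] using
    value_le (assign a b c) .oplus_odot

theorem le_ominus_oplus : a ≤ ominus a l ⊕ₘ MCOps.const l := by
  simpa only [value_oplus, value_ominus, value_const, value_va, value_vb, value_vc] using
    value_le (assign a a a) (.le_ominus_oplus l)

theorem oplus_ominus_le : ominus (a ⊕ₘ MCOps.const l) l ≤ a := by
  simpa only [value_oplus, value_ominus, value_const, value_va, value_vb, value_vc] using
    value_le (assign a a a) (.oplus_ominus_le l)

theorem inf_iterate_le (n m : ℕ) : a ⊓ (fun t => t ⊕ₘ (c ⊙ₘ MCOps.const l))^[n] b ≤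
    (fun t => t ⊙ₘ (c ⊕ₘ MCOps.const l))^[m] a ⊔ b := by
  simpa only [value_oplus, value_odot, value_meet, value_join, value_const, value_va, value_vb,
    value_vc, value_iterate_oplus, value_iterate_odot] using
    value_le (assign a b c) (.interpolate l n m)

theorem const_sup_const :
    (MCOps.const l : A.carrier) ⊔ MCOps.const m = MCOps.const (max l m) := by
  let v : ℕ → A.carrier := fun _ => MCOps.const 0
  simpa only [value_join, value_const] using value_eq v (.const_join l m)

theorem const_inf_const :
    (MCOps.const l : A.carrier) ⊓ MCOps.const m = MCOps.const (min l m) := by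
  let v : ℕ → A.carrier := fun _ => MCOps.const 0
  simpa only [value_meet, value_const] using value_eq v (.const_meet l m)

theorem const_oplus_const :
    (MCOps.const l : A.carrier) ⊕ₘ MCOps.const m = MCOps.const (l ⊕ₘ m) := by
  let v : ℕ → A.carrier := fun _ => MCOps.const 0
  simpa only [value_oplus, value_const] using value_eq v (.const_oplus l m (l ⊕ₘ m) rfl)

theorem const_odot_const :
    (MCOps.const l : A.carrier) ⊙ₘ MCOps.const m = MCOps.const (l ⊙ₘ m) := by
  let v : ℕ → A.carrier := fun _ => MCOps.const 0
  simpa only [value_odot, value_const] using value_eq v (.const_odot l m (l ⊙ₘ m) rfl)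

theorem ominus_const : ominus (MCOps.const l : A.carrier) m = MCOps.const (ominus l m) :=
  const_odot_const _ _

variable {l m} in
theorem const_mono (h : l ≤ m) : (MCOps.const l : A.carrier) ≤ MCOps.const m := by
  rw [← sup_eq_right, const_sup_const, max_eq_right h]

theorem le_oplus_right : a ≤ a ⊕ₘ b := by
  conv_lhs => rw [← oplus_const_zero a, oplus_comm' a]
  rw [oplus_comm' a, ← sup_eq_right, ← sup_oplus, sup_eq_right.mpr (const_zero_le b)]

theorem odot_le_left : a ⊙ₘ b ≤ a := by
  conv_rhs => rw [← odot_const_one a, odot_comm' a]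
  rw [odot_comm' a, ← sup_eq_right, ← sup_odot, sup_eq_right.mpr (le_const_one b)]

variable (x : ℕ → A.carrier)

theorem deltaOp_const : deltaOp (fun _ => a) = a := by
  simpa only [value_delta, value_va, value_vb, value_vc] using value_eq (assign a a a) .delta_const

theorem deltaOp_ominus : (deltaOp fun n => ominus a (halfPow n)) = a := by
  simpa only [value_delta, value_ominus, value_va, value_vb, value_vc] using
    value_eq (assign a a a) .delta_ominus

variable {x} in
theorem deltaOp_mono {y : ℕ → A.carrier} (h : x ≤ y) : deltaOp x ≤ deltaOp y := by
  have hd := value_le (Sum.elim x y) .delta_join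
  simp only [value_delta, value_join, value_var, Sum.elim_inl, Sum.elim_inr] at hd
  simpa only [fun n => sup_eq_right.mpr (h n)] using hd

theorem rho_le_deltaOp (n : ℕ) : rho x n ≤ deltaOp x := by
  simpa only [value_delta, value_rho, value_var] using value_le x (.rho_le_delta n)

theorem deltaOp_le_rho (n : ℕ) : deltaOp x ≤ rho x n ⊕ₘ MCOps.const (halfPow (n - 1)) := by
  simpa only [value_delta, value_rho, value_oplus, value_const, value_var] using
    value_le x (.delta_le_rho n)

variable {a b} in
/-- Elements are determined, up to the order, by their truncations: this is the Archimedean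
property that `δ` enforces. -/
theorem le_of_forall_ominus_le (h : ∀ n, ominus a (halfPow n) ≤ b) : a ≤ b := by
  rw [← deltaOp_ominus a, ← deltaOp_const b]
  exact deltaOp_mono h

end Laws

/-! ### Compatible preorders -/

section Compatible

variable {A : Variety.{u} mcInfty}

/-- The unary maps obtained from the four binary operations by fixing the second argument. -/
inductive IsTranslation : (A.carrier → A.carrier) → Prop
  | oplus (c : A.carrier) : IsTranslation fun a => a ⊕ₘ c
  | odot (c : A.carrier) : IsTranslation fun a => a ⊙ₘ c
  | sup (c : A.carrier) : IsTranslation fun a => a ⊔ c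
  | inf (c : A.carrier) : IsTranslation fun a => a ⊓ c

/-- A preorder on an algebra that extends its order and is preserved by `⊕`, `⊙`, `∨` and `∧`. Such
preorders play the role of congruences for the finitary operations. -/
structure IsCompatible (R : A.carrier → A.carrier → Prop) : Prop where
  of_le {a b : A.carrier} : a ≤ b → R a b
  trans {a b c : A.carrier} : R a b → R b c → R a c
  map {f : A.carrier → A.carrier} (hf : IsTranslation f) {a b : A.carrier} : R a b → R (f a) (f b)

theorem IsTranslation.mono {f : A.carrier → A.carrier} (hf : IsTranslation f) : Monotone f := by
  intro a b h
  cases hf with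
  | oplus c => simpa only [← sup_eq_right, ← sup_oplus] using congrArg (· ⊕ₘ c) (sup_eq_right.mpr h)
  | odot c => simpa only [← sup_eq_right, ← sup_odot] using congrArg (· ⊙ₘ c) (sup_eq_right.mpr h)
  | sup c => exact sup_le_sup_right h c
  | inf c => exact inf_le_inf_right c h

theorem isCompatible_le : IsCompatible fun a b : A.carrier => a ≤ b :=
  ⟨id, le_trans, fun hf => @hf.mono _ _⟩

/-- With `apply_odot_le`, this is what makes preorders generated by `u ≤ 0` or `1 ≤ u` compatible.
For `⊙` it is weak associativity. -/
theorem IsTranslation.apply_oplus_le {f : A.carrier → A.carrier} (hf : IsTranslation f)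
    (b u : A.carrier) : f (b ⊕ₘ u) ≤ f b ⊕ₘ u := by
  cases hf with
  | oplus c => beta_reduce; rw [oplus_assoc', oplus_assoc', oplus_comm' u c]
  | odot c => rw [oplus_comm' b u, oplus_comm' _ u]; exact oplus_odot_le u b c
  | sup c => rw [sup_oplus]; exact sup_le_sup_left (le_oplus_right c u) _
  | inf c => rw [inf_oplus]; exact inf_le_inf_left _ (le_oplus_right c u)

theorem IsTranslation.apply_odot_le {f : A.carrier → A.carrier} (hf : IsTranslation f)
    (a u : A.carrier) : f a ⊙ₘ u ≤ f (a ⊙ₘ u) := by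
  cases hf with
  | oplus c => beta_reduce; rw [oplus_comm' a c, oplus_comm' _ c]; exact oplus_odot_le c a u
  | odot c => beta_reduce; rw [odot_assoc', odot_assoc', odot_comm' u c]
  | sup c => rw [sup_odot]; exact sup_le_sup_left (odot_le_left c u) _
  | inf c => rw [inf_odot]; exact inf_le_inf_left _ (odot_le_left c u)

namespace IsCompatible

variable {R : A.carrier → A.carrier → Prop} (hR : IsCompatible R)
include hR

theorem refl (a : A.carrier) : R a a := hR.of_le le_rfl

theorem oplus {a b c d : A.carrier} (h : R a b) (h' : R c d) : R (a ⊕ₘ c) (b ⊕ₘ d) := by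
  have h2 := hR.map (.oplus b) h'
  rw [oplus_comm' c b, oplus_comm' d b] at h2
  exact hR.trans (hR.map (.oplus c) h) h2

theorem odot {a b c d : A.carrier} (h : R a b) (h' : R c d) : R (a ⊙ₘ c) (b ⊙ₘ d) := by
  have h2 := hR.map (.odot b) h'
  rw [odot_comm' c b, odot_comm' d b] at h2
  exact hR.trans (hR.map (.odot c) h) h2

theorem sup {a b c d : A.carrier} (h : R a b) (h' : R c d) : R (a ⊔ c) (b ⊔ d) := by
  have h2 := hR.map (.sup b) h'
  rw [sup_comm c b, sup_comm d b] at h2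
  exact hR.trans (hR.map (.sup c) h) h2

theorem inf {a b c d : A.carrier} (h : R a b) (h' : R c d) : R (a ⊓ c) (b ⊓ d) := by
  have h2 := hR.map (.inf b) h'
  rw [inf_comm c b, inf_comm d b] at h2
  exact hR.trans (hR.map (.inf c) h) h2

theorem ominus_right {a b : A.carrier} (h : R a b) (l : I) :
    R (ominus a l) (ominus b l) := hR.map (.odot _) h

theorem iterate {f : A.carrier → A.carrier} (hf : IsTranslation f) (n : ℕ) {a b : A.carrier}
    (h : R a b) : R (f^[n] a) (f^[n] b) := by
  induction n generalizing a b with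
  | zero => exact h
  | succ n ih => exact ih (hR.map hf h)

/-- The compatible preorder generated by `R` and `u ≤ 0`. -/
theorem oplus_iterate (u : A.carrier) :
    IsCompatible fun a b => ∃ n : ℕ, R a ((fun t => t ⊕ₘ u)^[n] b) where
  of_le h := ⟨0, hR.of_le h⟩
  trans := by
    rintro a b c ⟨n, h⟩ ⟨m, h'⟩
    refine ⟨n + m, ?_⟩
    rw [Function.iterate_add_apply]
    exact hR.trans h (hR.iterate (.oplus u) n h')
  map := by
    rintro f hf a b ⟨n, h⟩
    refine ⟨n, hR.trans (hR.map hf h) (hR.of_le ?_)⟩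
    clear h
    induction n generalizing b with
    | zero => exact le_rfl
    | succ n ih =>
      rw [Function.iterate_succ_apply, Function.iterate_succ_apply]
      exact ih.trans (isCompatible_le.iterate (.oplus u) n (hf.apply_oplus_le b u))

/-- The compatible preorder generated by `R` and `1 ≤ u`. -/
theorem odot_iterate (u : A.carrier) :
    IsCompatible fun a b => ∃ n : ℕ, R ((fun t => t ⊙ₘ u)^[n] a) b where
  of_le h := ⟨0, hR.of_le h⟩
  trans := by
    rintro a b c ⟨n, h⟩ ⟨m, h'⟩
    refine ⟨m + n, ?_⟩
    rw [Function.iterate_add_apply]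
    exact hR.trans (hR.iterate (.odot u) m h) h'
  map := by
    rintro f hf a b ⟨n, h⟩
    refine ⟨n, hR.trans (hR.of_le ?_) (hR.map hf h)⟩
    clear h
    induction n generalizing a with
    | zero => exact le_rfl
    | succ n ih =>
      rw [Function.iterate_succ_apply, Function.iterate_succ_apply]
      exact (isCompatible_le.iterate (.odot u) n (hf.apply_odot_le a u)).trans ih

end IsCompatible

/-- If `a ≰ b`, then a compatible preorder `R` that is maximal with `¬ R a b` compares every element
with every constant: if adding `c ⊙ l ≤ 0` and adding `1 ≤ c ⊕ l` both enlarged `R`, both enlarged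
preorders would relate `a` to `b`, and then so would `R`, by the interpolation axiom. -/
theorem exists_isCompatible_comparable {a b : A.carrier} (h : ¬ a ≤ b) :
    ∃ R : A.carrier → A.carrier → Prop, IsCompatible R ∧ ¬ R a b ∧
      ∀ (c : A.carrier) (l : I), R c (MCOps.const l) ∨ R (MCOps.const l) c := by
  obtain ⟨R, -, hm⟩ := zorn_le_nonempty₀
    {R : A.carrier → A.carrier → Prop | IsCompatible R ∧ ¬ R a b}
    (fun C hC hchain R₀ hR₀ => by
      refine ⟨fun x y => ∃ R ∈ C, R x y, ⟨⟨?_, ?_, ?_⟩, ?_⟩, fun R hR x y hxy => ⟨R, hR, hxy⟩⟩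
      · exact fun hle => ⟨R₀, hR₀, (hC hR₀).1.of_le hle⟩
      · rintro x y z ⟨R₁, h₁, hxy⟩ ⟨R₂, h₂, hyz⟩
        rcases hchain.total h₁ h₂ with hle | hle
        · exact ⟨R₂, h₂, (hC h₂).1.trans (hle _ _ hxy) hyz⟩
        · exact ⟨R₁, h₁, (hC h₁).1.trans hxy (hle _ _ hyz)⟩
      · rintro f hf x y ⟨R₁, h₁, hxy⟩
        exact ⟨R₁, h₁, (hC h₁).1.map hf hxy⟩
      · rintro ⟨R₁, h₁, hab⟩
        exact (hC h₁).2 hab)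
    _ ⟨isCompatible_le, h⟩
  have hR : IsCompatible R := hm.prop.1
  refine ⟨R, hR, hm.prop.2, fun c l => ?_⟩
  -- the interpolation axiom is used with `c ⊙ (1 - l)` and `c ⊕ (1 - l)`
  set l' := unitInterval.symm l with hl'
  by_cases h₁ : ∃ n : ℕ, R a ((fun t => t ⊕ₘ (c ⊙ₘ MCOps.const l'))^[n] b)
  · by_cases h₂ : ∃ m : ℕ, R ((fun t => t ⊙ₘ (c ⊕ₘ MCOps.const l'))^[m] a) b
    · obtain ⟨n, hn⟩ := h₁
      obtain ⟨m, hm'⟩ := h₂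
      refine absurd ?_ hm.prop.2
      have h3 := hR.inf (hR.refl a) hn
      have h4 := hR.sup hm' (hR.refl b)
      rw [inf_idem] at h3
      rw [sup_idem] at h4
      exact hR.trans h3 (hR.trans (hR.of_le (inf_iterate_le a b c l' n m)) h4)
    · right
      have h3 : R (MCOps.const 1) (c ⊕ₘ MCOps.const l') := by
        refine hm.le_of_ge ⟨hR.odot_iterate _, h₂⟩ (fun x y hxy => ⟨0, hxy⟩) _ _
          ⟨1, hR.of_le ?_⟩
        rw [Function.iterate_one, odot_comm', odot_const_one]
      have h4 := hR.trans (hR.ominus_right h3 l') (hR.of_le (oplus_ominus_le c l'))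
      rwa [ominus, odot_comm', odot_const_one, hl', unitInterval.symm_symm] at h4
  · left
    have h3 : R (c ⊙ₘ MCOps.const l') (MCOps.const 0) := by
      refine hm.le_of_ge ⟨hR.oplus_iterate _, h₁⟩ (fun x y hxy => ⟨0, hxy⟩) _ _
        ⟨1, hR.of_le ?_⟩
      rw [Function.iterate_one, oplus_comm', oplus_const_zero]
    have h4 := hR.trans (hR.of_le (le_ominus_oplus c l)) (hR.map (.oplus _) h3)
    rwa [oplus_comm', oplus_const_zero] at h4

end Compatible

/-! ### Homomorphisms to `[0,1]` separate the elements of an algebra -/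

theorem coe_halfPow (n : ℕ) : ((halfPow n : I) : ℝ) = 1 / 2 ^ n := rfl

theorem halfPow_pos (n : ℕ) : 0 < (halfPow n : ℝ) := by rw [coe_halfPow]; positivity

theorem halfPow_succ (n : ℕ) : (halfPow n : ℝ) = 2 * halfPow (n + 1) := by
  rw [coe_halfPow, coe_halfPow, pow_succ]; field_simp

theorem tendsto_halfPow : Tendsto halfPow atTop (𝓝 0) := by
  rw [tendsto_subtype_rng]
  simpa [coe_halfPow] using tendsto_pow_atTop_nhds_zero_of_lt_one (r := (1 / 2 : ℝ))
    (by norm_num) (by norm_num)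

theorem oplus_zero_right (l : I) : l ⊕ₘ (0 : I) = l :=
  Subtype.ext (by rw [coe_oplus]; simp [l.2.2])

theorem ominus_zero_right (l : I) : ominus l 0 = l :=
  Subtype.ext (by rw [coe_ominus]; simp [l.2.1])

theorem tendsto_oplus_halfPow (l : I) : Tendsto (fun n => l ⊕ₘ halfPow n) atTop (𝓝 l) := by
  have h := (continuous_oplus.comp (Continuous.prodMk_right l)).tendsto 0
  simp only [Function.comp_def, oplus_zero_right] at h
  exact h.comp tendsto_halfPow

theorem tendsto_ominus_halfPow (l : I) : Tendsto (fun n => ominus l (halfPow n)) atTop (𝓝 l) := by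
  have h := (continuous_odot.comp ((Continuous.prodMk_right l).comp
    unitInterval.continuous_symm)).tendsto 0
  have h0 : l ⊙ₘ unitInterval.symm 0 = l := ominus_zero_right l
  simp only [Function.comp_def, h0] at h
  exact h.comp tendsto_halfPow

theorem coe_iterate_oplus (u : I) (n : ℕ) :
    (((fun t : I => t ⊕ₘ u)^[n] 0 : I) : ℝ) = min (n * (u : ℝ)) 1 := by
  induction n with
  | zero => simp
  | succ n ih =>
    have := u.2
    rw [Function.iterate_succ_apply', coe_oplus, ih]
    push_cast
    grind

theorem exists_iterate_oplus_eq_one {u : I} (hu : 0 < u) :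
    ∃ n : ℕ, (fun t : I => t ⊕ₘ u)^[n] 0 = 1 := by
  obtain ⟨n, hn⟩ := Archimedean.arch (1 : ℝ) (y := (u : ℝ)) hu
  refine ⟨n, Subtype.ext ?_⟩
  rw [coe_iterate_oplus, min_eq_right (by simpa using hn)]
  rfl

section Value

variable {A : Variety.{u} mcInfty}

theorem const_iterate_oplus (u l : I) (n : ℕ) :
    (fun t : A.carrier => t ⊕ₘ MCOps.const u)^[n] (MCOps.const l) =
      MCOps.const ((fun t : I => t ⊕ₘ u)^[n] l) := by
  induction n generalizing l with
  | zero => rfl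
  | succ n ih => rw [Function.iterate_succ_apply, const_oplus_const, ih]; rfl

/-- In a nontrivial compatible preorder, constants are ordered as in `[0,1]`. -/
theorem IsCompatible.const_le_const {R : A.carrier → A.carrier → Prop} (hR : IsCompatible R)
    {a b : A.carrier} (hab : ¬ R a b) {l m : I} (h : R (MCOps.const l) (MCOps.const m)) :
    l ≤ m := by
  by_contra! hlm
  -- the positive constant `u = l ⊖ m` lies below `0`, hence so do its multiples, and `1`
  have hu : 0 < ominus l m := by
    rw [← Subtype.coe_lt_coe, coe_ominus]
    exact lt_max_of_lt_left (sub_pos.mpr hlm)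
  have h0 : R (MCOps.const (ominus l m)) (MCOps.const 0) := by
    have h1 := hR.ominus_right h m
    have h2 : ominus m m = 0 := Subtype.ext (by rw [coe_ominus]; simp)
    rwa [ominus_const, ominus_const, h2] at h1
  obtain ⟨n, hn⟩ := exists_iterate_oplus_eq_one hu
  have h1 : ∀ n : ℕ, R ((fun t => t ⊕ₘ MCOps.const (ominus l m))^[n] (MCOps.const 0))
      (MCOps.const 0) := by
    intro n
    induction n with
    | zero => exact hR.refl _
    | succ n ih =>
      rw [Function.iterate_succ_apply']
      refine hR.trans (hR.oplus ih h0) ?_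
      rw [oplus_const_zero]
      exact hR.refl _
  have h2 := h1 n
  rw [const_iterate_oplus, hn] at h2
  exact hab (hR.trans (hR.of_le (le_const_one a)) (hR.trans h2 (hR.of_le (const_zero_le b))))

/-- `φ c` is the number in `[0,1]` at which the constants pass, in the preorder `R`, from lying
below `c` to lying above it. Nothing is required of the constant `φ c` itself. -/
def IsCut (R : A.carrier → A.carrier → Prop) (φ : A.carrier → I) : Prop :=
  ∀ (c : A.carrier) (l : I), (l < φ c → R (MCOps.const l) c) ∧ (φ c < l → R c (MCOps.const l))

theorem exists_isCut {R : A.carrier → A.carrier → Prop} (hR : IsCompatible R)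
    (hc : ∀ (c : A.carrier) (l : I), R c (MCOps.const l) ∨ R (MCOps.const l) c) :
    ∃ φ, IsCut R φ := by
  suffices h : ∀ c : A.carrier, ∃ r : I, ∀ l : I,
      (l < r → R (MCOps.const l) c) ∧ (r < l → R c (MCOps.const l)) from
    ⟨fun c => (h c).choose, fun c => (h c).choose_spec⟩
  intro c
  refine ⟨sSup {l : I | R (MCOps.const l) c}, fun l => ⟨fun hl => ?_, fun hl => ?_⟩⟩
  · obtain ⟨m, hm, hlm⟩ := lt_sSup_iff.mp hl
    exact hR.trans (hR.of_le (const_mono hlm.le)) hm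
  · exact (hc c l).resolve_right fun h => hl.not_ge (le_sSup h)

namespace IsCut

variable {R : A.carrier → A.carrier → Prop} {φ : A.carrier → I} (hφ : IsCut R φ)
  (hR : IsCompatible R) {a b : A.carrier} (hab : ¬ R a b)
include hφ hR

theorem const_ominus (c : A.carrier) (n : ℕ) : R (MCOps.const (ominus (φ c) (halfPow n))) c := by
  rcases (φ c).2.1.eq_or_lt with h | h
  · have h0 : ominus (φ c) (halfPow n) = 0 := Subtype.ext (by
      rw [coe_ominus, ← h]; exact max_eq_right (by linarith [halfPow_pos n]))
    rw [h0]
    exact hR.of_le (const_zero_le c)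
  · refine (hφ c _).1 ?_
    rw [← Subtype.coe_lt_coe, coe_ominus]
    exact max_lt (by linarith [halfPow_pos n]) h

theorem const_oplus (c : A.carrier) (n : ℕ) : R c (MCOps.const (φ c ⊕ₘ halfPow n)) := by
  rcases (φ c).2.2.eq_or_lt with h | h
  · have h0 : φ c ⊕ₘ halfPow n = 1 := Subtype.ext (by
      rw [coe_oplus, h]; exact min_eq_right (by linarith [halfPow_pos n]))
    rw [h0]
    exact hR.of_le (le_const_one c)
  · refine (hφ c _).2 ?_
    rw [← Subtype.coe_lt_coe, coe_oplus]
    exact lt_min (by linarith [halfPow_pos n]) h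

include hab

theorem le_of_const {c : A.carrier} {l : I} (h : R (MCOps.const l) c) : l ≤ φ c := by
  refine le_of_forall_gt fun m hm => ?_
  obtain ⟨k, hk, hkm⟩ := exists_between hm
  exact (hR.const_le_const hab (hR.trans h ((hφ c k).2 hk))).trans_lt hkm

theorem le_const {c : A.carrier} {l : I} (h : R c (MCOps.const l)) : φ c ≤ l := by
  refine le_of_forall_lt fun m hm => ?_
  obtain ⟨k, hk, hkm⟩ := exists_between hm
  exact hk.trans_le (hR.const_le_const hab (hR.trans ((hφ c k).1 hkm) h))

theorem apply_const (l : I) : φ (MCOps.const l) = l :=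
  le_antisymm (hφ.le_const hR hab (hR.refl _)) (hφ.le_of_const hR hab (hR.refl _))

theorem monotone : Monotone φ := by
  refine fun c d h => le_of_tendsto' (tendsto_ominus_halfPow (φ c)) fun n => ?_
  exact hφ.le_of_const hR hab (hR.trans (hφ.const_ominus hR c n) (hR.of_le h))

/-- A cut preserves every binary operation that the preorder respects, that is continuous on
`[0,1]`, and whose values on constants are those computed in `[0,1]`. -/
theorem map_binary {g : A.carrier → A.carrier → A.carrier} {f : I → I → I}
    (hg : ∀ {a b c d : A.carrier}, R a b → R c d → R (g a c) (g b d))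
    (hf : Continuous fun p : I × I => f p.1 p.2)
    (hgf : ∀ l m : I, g (MCOps.const l) (MCOps.const m) = MCOps.const (f l m))
    (c d : A.carrier) : φ (g c d) = f (φ c) (φ d) := by
  have lim : ∀ {x y : ℕ → I}, Tendsto x atTop (𝓝 (φ c)) → Tendsto y atTop (𝓝 (φ d)) →
      Tendsto (fun n => f (x n) (y n)) atTop (𝓝 (f (φ c) (φ d))) := fun hx hy =>
    (hf.tendsto (φ c, φ d)).comp (hx.prodMk_nhds hy)
  apply le_antisymm
  · refine ge_of_tendsto' (lim (tendsto_oplus_halfPow _) (tendsto_oplus_halfPow _)) fun n => ?_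
    refine hφ.le_const hR hab ?_
    rw [← hgf]
    exact hg (hφ.const_oplus hR c n) (hφ.const_oplus hR d n)
  · refine le_of_tendsto' (lim (tendsto_ominus_halfPow _) (tendsto_ominus_halfPow _)) fun n => ?_
    refine hφ.le_of_const hR hab ?_
    rw [← hgf]
    exact hg (hφ.const_ominus hR c n) (hφ.const_ominus hR d n)

theorem map_oplus (c d : A.carrier) : φ (c ⊕ₘ d) = φ c ⊕ₘ φ d :=
  hφ.map_binary hR hab hR.oplus continuous_oplus const_oplus_const c d

theorem map_odot (c d : A.carrier) : φ (c ⊙ₘ d) = φ c ⊙ₘ φ d :=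
  hφ.map_binary hR hab hR.odot continuous_odot const_odot_const c d

theorem map_join (c d : A.carrier) : φ (c ∨ₘ d) = (φ c ∨ₘ φ d) :=
  hφ.map_binary hR hab hR.sup continuous_max const_sup_const c d

theorem map_meet (c d : A.carrier) : φ (c ∧ₘ d) = (φ c ∧ₘ φ d) :=
  hφ.map_binary hR hab hR.inf continuous_min const_inf_const c d

theorem map_joins (x : ℕ → A.carrier) (n : ℕ) : φ (joins x n) = joins (φ ∘ x) n := by
  induction n with
  | zero => rfl
  | succ n ih => simp only [joins, hφ.map_join hR hab, ih, Function.comp_apply]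

theorem map_rho (x : ℕ → A.carrier) (n : ℕ) : φ (rho x n) = rho (φ ∘ x) n := by
  induction n with
  | zero => rfl
  | succ n ih =>
    simp only [rho, hφ.map_meet hR hab, hφ.map_oplus hR hab, hφ.map_joins hR hab, ih,
      hφ.apply_const hR hab, const_def]

/-- Preservation of `δ` is automatic, because `δ` is squeezed between finitary terms that differ by
arbitrarily small constants. -/
theorem map_deltaOp (x : ℕ → A.carrier) : φ (deltaOp x) = deltaI (φ ∘ x) := by
  have hmono := hφ.monotone hR hab
  apply le_antisymm
  · have h := (continuous_oplus.tendsto (deltaI (φ ∘ x), 0)).comp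
      ((tendsto_rho (φ ∘ x)).prodMk_nhds
        (tendsto_halfPow.comp (tendsto_sub_atTop_nat 1)))
    simp only [oplus_zero_right] at h
    refine ge_of_tendsto' h fun n => ?_
    have h1 := hmono (deltaOp_le_rho x n)
    rwa [hφ.map_oplus hR hab, hφ.map_rho hR hab, hφ.apply_const hR hab] at h1
  · refine le_of_tendsto' (tendsto_rho (φ ∘ x)) fun n => ?_
    rw [← hφ.map_rho hR hab]
    exact hmono (rho_le_deltaOp x n)

/-- The homomorphism to `[0,1]` given by a cut. -/
def hom : Variety.Hom A algI where
  toFun := φ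
  map_interp o x := by
    cases o with
    | oplus => exact (congrArg φ (interp_oplus x)).trans (hφ.map_oplus hR hab _ _)
    | odot => exact (congrArg φ (interp_odot x)).trans (hφ.map_odot hR hab _ _)
    | join => exact (congrArg φ (interp_join x)).trans (hφ.map_join hR hab _ _)
    | meet => exact (congrArg φ (interp_meet x)).trans (hφ.map_meet hR hab _ _)
    | const l => exact (congrArg φ (interp_const l x)).trans (hφ.apply_const hR hab l)
    | delta => exact hφ.map_deltaOp hR hab x

end IsCut

/-- Homomorphisms to `[0,1]` detect the order of an algebra. -/
theorem exists_hom_lt {a b : A.carrier} (h : ¬ a ≤ b) :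
    ∃ x : Variety.Hom A algI, homVal A x b < homVal A x a := by
  obtain ⟨n, hn⟩ : ∃ n, ¬ ominus a (halfPow n) ≤ b := by
    by_contra! hall
    exact h (le_of_forall_ominus_le hall)
  obtain ⟨R, hR, hab, hc⟩ := exists_isCompatible_comparable hn
  obtain ⟨φ, hφ⟩ := exists_isCut hR hc
  refine ⟨hφ.hom hR hab, ?_⟩
  by_contra! hle
  have hle' : (φ a : ℝ) ≤ φ b := hle
  -- `a ⊖ 2⁻ⁿ ≤ (φ a ⊕ 2⁻⁽ⁿ⁺¹⁾) ⊖ 2⁻ⁿ ≤ φ b ⊖ 2⁻⁽ⁿ⁺¹⁾ ≤ b` in the preorder `R`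
  have h1 := hR.ominus_right (hφ.const_oplus hR a (n + 1)) (halfPow n)
  rw [ominus_const] at h1
  refine hab (hR.trans h1 (hR.trans (hR.of_le (const_mono ?_)) (hφ.const_ominus hR b (n + 1))))
  rw [← Subtype.coe_le_coe, coe_ominus, coe_ominus, coe_oplus, halfPow_succ n]
  refine max_le_max ?_ le_rfl
  linarith [min_le_left ((φ a : ℝ) + halfPow (n + 1)) 1]

end Value

/-! ### An ordered Stone–Weierstrass theorem -/

section StoneWeierstrass

variable {A : Variety.{u} mcInfty} (x y : Variety.Hom A algI) (a b : A.carrier) (l : I)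

theorem homVal_oplus : homVal A x (a ⊕ₘ b) = homVal A x a ⊕ₘ homVal A x b := x.map_interp .oplus _
theorem homVal_odot : homVal A x (a ⊙ₘ b) = homVal A x a ⊙ₘ homVal A x b := x.map_interp .odot _
theorem homVal_sup : homVal A x (a ⊔ b) = max (homVal A x a) (homVal A x b) :=
  x.map_interp .join _
theorem homVal_inf : homVal A x (a ⊓ b) = min (homVal A x a) (homVal A x b) :=
  x.map_interp .meet _
theorem homVal_const : homVal A x (MCOps.const l) = l := x.map_interp (.const l) _
theorem homVal_ominus : homVal A x (ominus a l) = ominus (homVal A x a) l := by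
  simp only [ominus, homVal_odot, homVal_const, const_def]
theorem homVal_deltaOp (c : ℕ → A.carrier) :
    homVal A x (deltaOp c) = deltaI fun n => homVal A x (c n) := x.map_interp .delta c
theorem homVal_iterate_oplus (n : ℕ) :
    homVal A x ((fun t => t ⊕ₘ a)^[n] b) = (fun t => t ⊕ₘ homVal A x a)^[n] (homVal A x b) := by
  induction n generalizing b with
  | zero => rfl
  | succ n ih => rw [Function.iterate_succ_apply, ih, homVal_oplus, Function.iterate_succ_apply]

theorem monotone_homVal : Monotone (homVal A x) := by
  intro a b h
  rw [← sup_eq_right.mpr h, homVal_sup]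
  exact le_max_left _ _

theorem continuous_homVal_apply : Continuous fun x : Variety.Hom A algI => homVal A x a :=
  (continuous_apply a).comp (isInducing_homVal A).continuous

variable {x y a} in
/-- A gap between two homomorphisms can be stretched to the whole interval: truncate from below,
then take a large multiple. -/
theorem exists_homVal_eq_one_eq_zero (h : homVal A y a < homVal A x a) :
    ∃ d, homVal A x d = 1 ∧ homVal A y d = 0 := by
  set l := homVal A y a with hl
  have hx : 0 < homVal A x (ominus a l) := by
    rw [homVal_ominus, ← Subtype.coe_lt_coe, coe_ominus]
    exact lt_max_of_lt_left (sub_pos.mpr h)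
  have hy : homVal A y (ominus a l) = 0 := by
    rw [homVal_ominus, ← hl]
    exact Subtype.ext (by rw [coe_ominus]; simp)
  obtain ⟨n, hn⟩ := exists_iterate_oplus_eq_one hx
  refine ⟨(fun t => t ⊕ₘ ominus a l)^[n] (MCOps.const 0), ?_, ?_⟩
  · rw [homVal_iterate_oplus, homVal_const, hn]
  · rw [homVal_iterate_oplus, homVal_const, hy]
    exact Subtype.ext (by rw [coe_iterate_oplus]; simp)

variable {f : Variety.Hom A algI → I} (hf : Monotone f)
include hf

/-- Interpolation of `f` at two points, up to inequalities; only for `x ≰ y` is it not solved by a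
constant. -/
theorem exists_le_homVal_homVal_le : ∃ a, f x ≤ homVal A x a ∧ homVal A y a ≤ f y := by
  by_cases h : x ≤ y
  · exact ⟨MCOps.const (f x), (homVal_const x _).ge, (homVal_const y _).trans_le (hf h)⟩
  · obtain ⟨c, hc⟩ := not_forall.mp h
    obtain ⟨d, hd1, hd0⟩ := exists_homVal_eq_one_eq_zero (not_le.mp hc)
    exact ⟨d, hd1 ▸ (f x).2.2, hd0 ▸ (f y).2.1⟩

/-- A monotone continuous function on `Max(A)` is a uniform limit of evaluations. -/
theorem exists_abs_homVal_sub_lt (hc : Continuous f) {ε : ℝ} (hε : 0 < ε) :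
    ∃ a, ∀ x, |(homVal A x a : ℝ) - f x| < ε := by
  have hfc : Continuous fun z => (f z : ℝ) := continuous_subtype_val.comp hc
  have hac : ∀ a, Continuous fun z : Variety.Hom A algI => (homVal A z a : ℝ) := fun a =>
    continuous_subtype_val.comp (continuous_homVal_apply a)
  -- a finite meet of interpolating elements exceeds `f` by less than `ε`, and still reaches `f x`
  have above : ∀ x, ∃ a, f x ≤ homVal A x a ∧
      ∀ z ∈ (Set.univ : Set (Variety.Hom A algI)), (homVal A z a : ℝ) < f z + ε := by
    intro x
    refine isCompact_univ.induction_on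
      (p := fun s => ∃ a, f x ≤ homVal A x a ∧ ∀ z ∈ s, (homVal A z a : ℝ) < f z + ε) ?_ ?_ ?_ ?_
    · exact ⟨MCOps.const 1, (homVal_const x 1).symm ▸ (f x).2.2, fun z hz => hz.elim⟩
    · rintro s t hst ⟨a, h1, h2⟩
      exact ⟨a, h1, fun z hz => h2 z (hst hz)⟩
    · rintro s t ⟨a, h1, h2⟩ ⟨b, h3, h4⟩
      refine ⟨a ⊓ b, (homVal_inf x a b).symm ▸ le_min h1 h3, fun z hz => ?_⟩
      have hl := Subtype.coe_le_coe.mpr (monotone_homVal z (inf_le_left (a := a) (b := b)))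
      have hr := Subtype.coe_le_coe.mpr (monotone_homVal z (inf_le_right (a := a) (b := b)))
      exact hz.elim (fun hz => hl.trans_lt (h2 z hz)) fun hz => hr.trans_lt (h4 z hz)
    · intro y _
      obtain ⟨a, h1, h2⟩ := exists_le_homVal_homVal_le x y hf
      have h2' : (homVal A y a : ℝ) < f y + ε := by
        linarith [Subtype.coe_le_coe.mpr h2]
      exact ⟨{z | (homVal A z a : ℝ) < f z + ε}, mem_nhdsWithin_of_mem_nhds
        ((isOpen_lt (hac a) (hfc.add continuous_const)).mem_nhds h2'), a, h1, fun z hz => hz⟩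
  -- a finite join of such meets is also nowhere below `f - ε`
  obtain ⟨a, ha⟩ : ∃ a, ∀ z ∈ (Set.univ : Set (Variety.Hom A algI)),
      (homVal A z a : ℝ) < f z + ε ∧ (f z : ℝ) - ε < homVal A z a := by
    suffices h : ∃ a, (∀ z, (homVal A z a : ℝ) < f z + ε) ∧
        ∀ z ∈ (Set.univ : Set (Variety.Hom A algI)), (f z : ℝ) - ε < homVal A z a by
      obtain ⟨a, h1, h2⟩ := h
      exact ⟨a, fun z hz => ⟨h1 z, h2 z hz⟩⟩
    refine isCompact_univ.induction_on
      (p := fun s => ∃ a, (∀ z, (homVal A z a : ℝ) < f z + ε) ∧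
        ∀ z ∈ s, (f z : ℝ) - ε < homVal A z a) ?_ ?_ ?_ ?_
    · refine ⟨MCOps.const 0, fun z => ?_, fun z hz => hz.elim⟩
      rw [homVal_const]
      exact add_pos_of_nonneg_of_pos (f z).2.1 hε
    · rintro s t hst ⟨a, h1, h2⟩
      exact ⟨a, h1, fun z hz => h2 z (hst hz)⟩
    · rintro s t ⟨a, h1, h2⟩ ⟨b, h3, h4⟩
      refine ⟨a ⊔ b, fun z => ?_, fun z hz => ?_⟩
      · rw [homVal_sup]
        rcases max_choice (homVal A z a) (homVal A z b) with h | h <;> rw [h]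
        exacts [h1 z, h3 z]
      · have hl := Subtype.coe_le_coe.mpr (monotone_homVal z (le_sup_left (a := a) (b := b)))
        have hr := Subtype.coe_le_coe.mpr (monotone_homVal z (le_sup_right (a := a) (b := b)))
        exact hz.elim (fun hz => (h2 z hz).trans_le hl) fun hz => (h4 z hz).trans_le hr
    · intro x _
      obtain ⟨a, h1, h2⟩ := above x
      have h1' : (f x : ℝ) - ε < homVal A x a := by
        linarith [Subtype.coe_le_coe.mpr h1]
      exact ⟨{z | (f z : ℝ) - ε < homVal A z a}, mem_nhdsWithin_of_mem_nhds
        ((isOpen_lt (hfc.sub continuous_const) (hac a)).mem_nhds h1'), a,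
        fun z => h2 z trivial, fun z hz => hz⟩
  refine ⟨a, fun x => abs_lt.mpr ⟨?_, ?_⟩⟩ <;> linarith [(ha x trivial).1, (ha x trivial).2]

/-- Every monotone continuous function on `Max(A)` is an evaluation: `δ` computes the limit of a
sequence of approximations that increases by steps of at most `2⁻ⁿ`. -/
theorem exists_homVal_eq (hc : Continuous f) : ∃ a, ∀ x, homVal A x a = f x := by
  -- an approximation of `f ⊖ 2⁻⁽ⁿ⁺¹⁾` up to `2⁻⁽ⁿ⁺²⁾`, diminished by that error, lies in the gap
  have happ : ∀ n : ℕ, ∃ a, ∀ x, ominus (f x) (halfPow n) ≤ homVal A x a ∧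
      homVal A x a ≤ ominus (f x) (halfPow (n + 1)) := by
    intro n
    have h1 := halfPow_succ n
    have h2 := halfPow_succ (n + 1)
    obtain ⟨a, ha⟩ := exists_abs_homVal_sub_lt (f := fun x => ominus (f x) (halfPow (n + 1)))
      (fun x y h => odot_mono (hf h) le_rfl) (continuous_odot.comp (hc.prodMk continuous_const))
      (halfPow_pos (n + 2))
    refine ⟨ominus a (halfPow (n + 2)), fun x => ?_⟩
    have h3 := abs_lt.mp (ha x)
    rw [homVal_ominus, ← Subtype.coe_le_coe, ← Subtype.coe_le_coe]
    simp only [coe_ominus] at h3 ⊢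
    have h4 := le_max_left ((f x : ℝ) - halfPow (n + 1)) 0
    exact ⟨max_le_max (by linarith) le_rfl, max_le (by linarith) (le_max_right _ _)⟩
  choose a ha using happ
  refine ⟨deltaOp a, fun x => ?_⟩
  rw [homVal_deltaOp]
  refine deltaI_eq (fun n => (ha n x).2.trans (ha (n + 1) x).1) (fun n => ?_) ?_
  · have h1 : homVal A x (a (n + 1)) ≤ f x := by
      refine (ha (n + 1) x).2.trans ?_
      rw [← Subtype.coe_le_coe, coe_ominus]
      exact max_le (by linarith [halfPow_pos (n + 2)]) (f x).2.1
    have h2 := (ha n x).1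
    rw [← Subtype.coe_le_coe] at h1 h2 ⊢
    rw [coe_ominus] at h2
    rw [coe_oplus]
    have h3 := le_max_left ((f x : ℝ) - halfPow n) 0
    exact le_min (by linarith) (homVal A x _).2.2
  · exact tendsto_of_tendsto_of_tendsto_of_le_of_le (tendsto_ominus_halfPow (f x))
      ((tendsto_ominus_halfPow (f x)).comp (tendsto_add_atTop_nat 1))
      (fun n => (ha n x).1) fun n => (ha n x).2

end StoneWeierstrass

/-! ### Points of a compact ordered space -/

section Points

theorem isClosed_lowerClosure_of_isClosed {X : Type*} [TopologicalSpace X] [PartialOrder X]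
    [CompactSpace X] [OrderClosedTopology X] {s : Set X} (hs : IsClosed s) :
    IsClosed (lowerClosure s : Set X) := by
  have h : (lowerClosure s : Set X) = Prod.fst '' ({p : X × X | p.1 ≤ p.2} ∩ Prod.snd ⁻¹' s) := by
    ext y
    simp only [SetLike.mem_coe, mem_lowerClosure, Set.mem_image, Set.mem_inter_iff,
      Set.mem_ofPred_eq, Set.mem_preimage, Prod.exists, exists_and_right, exists_eq_right]
    exact exists_congr fun x => and_comm
  rw [h]
  exact ((OrderClosedTopology.isClosed_le'.inter
    (hs.preimage continuous_snd)).isCompact.image continuous_fst).isClosed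

/-- Nachbin's separation property of compact ordered spaces: between a closed set and an open lower
set that contains it, there is an open lower set whose closure stays inside. -/
theorem exists_isLowerSet_isOpen_between {X : Type*} [TopologicalSpace X] [PartialOrder X]
    [CompactSpace X] [OrderClosedTopology X] {c u : Set X} (hc : IsClosed c) (hl : IsLowerSet u)
    (hu : IsOpen u) (hcu : c ⊆ u) :
    ∃ v, IsOpen v ∧ c ⊆ v ∧ closure v ⊆ u ∧ IsLowerSet v := by
  obtain ⟨w, hw, hcw, hwu⟩ := normal_exists_closure_subset
    (isClosed_lowerClosure_of_isClosed hc) hu (lowerClosure_min hcu hl)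
  have : CompactSpace Xᵒᵈ := inferInstanceAs (CompactSpace X)
  refine ⟨(upperClosure wᶜ : Set X)ᶜ, ?_, ?_, ?_, (upperClosure wᶜ).upper.compl⟩
  · exact (isClosed_lowerClosure_of_isClosed (X := Xᵒᵈ) hw.isClosed_compl).isOpen_compl
  · rintro x hx ⟨y, hy, hyx⟩
    exact hy (hcw ⟨x, hx, hyx⟩)
  · refine (closure_mono ?_).trans hwu
    exact Set.compl_subset_comm.mp subset_upperClosure

/-- Urysohn's function is monotone if all the open sets used to construct it are lower sets. -/
theorem monotone_urysohns_lim {X : Type*} [TopologicalSpace X] [PartialOrder X]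
    (c : Urysohns.CU fun _ u : Set X => IsLowerSet u) : Monotone c.lim := by
  have happ : ∀ (n : ℕ) (c : Urysohns.CU fun _ u : Set X => IsLowerSet u),
      Monotone (c.approx n) := by
    intro n
    induction n with
    | zero =>
      intro c x y h
      by_cases hx : x ∈ c.U
      · have h0 : c.approx 0 x = 0 :=
          Set.indicator_of_notMem (show x ∉ c.Uᶜ from fun h => h hx) _
        exact h0.trans_le (c.approx_nonneg 0 y)
      · exact (c.approx_le_one 0 x).trans_eq
          (c.approx_of_notMem_U 0 fun hy => hx (c.P_C_U h hy)).symm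
    | succ n ih => exact fun c x y h => midpoint_le_midpoint (ih c.left h) (ih c.right h)
  exact fun x y h => le_of_tendsto_of_tendsto' (c.tendsto_approx_atTop x)
    (c.tendsto_approx_atTop y) fun n => happ n c h

variable {X : PosComp.{u}}

/-- Monotone continuous functions to `[0,1]` detect the order of a compact ordered space. -/
theorem exists_continuousOrderHom_lt {x y : X.carrier} (h : ¬ x ≤ y) :
    ∃ f : X.carrier →Co I, f y < f x := by
  let c : Urysohns.CU fun _ u : Set X.carrier => IsLowerSet u :=
    { C := {y}
      U := (Set.Ici x)ᶜ
      P_C_U := (isUpperSet_Ici x).compl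
      closed_C := isClosed_singleton
      open_U := isClosed_Ici.isOpen_compl
      subset := Set.singleton_subset_iff.mpr h
      hP := fun hc hl hu hcu => by
        obtain ⟨v, h1, h2, h3, h4⟩ := exists_isLowerSet_isOpen_between hc hl hu hcu
        exact ⟨v, h1, h2, h3, h4, hl⟩ }
  refine ⟨⟨⟨fun z => ⟨c.lim z, c.lim_mem_Icc z⟩, fun z w h => monotone_urysohns_lim c h⟩,
    c.continuous_lim.subtype_mk _⟩, ?_⟩
  have hy : c.lim y = 0 := c.lim_of_mem_C y rfl
  have hx : c.lim x = 1 := c.lim_of_notMem_U x fun h => h (Set.self_mem_Ici)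
  change c.lim y < c.lim x
  rw [hx, hy]
  exact zero_lt_one

/-- The evaluation at a point, as a homomorphism `C(X) → [0,1]`. -/
def pointHom (x : X.carrier) : Variety.Hom (contAlg X) algI :=
  ⟨fun f : X.carrier →Co I => f x, fun _ _ => rfl⟩

theorem oplus_self_eq_one {l : I} (h : (1 / 2 : ℝ) ≤ l) : l ⊕ₘ l = 1 :=
  Subtype.ext (by rw [coe_oplus]; exact min_eq_right (by linarith))

theorem odot_self_eq_zero {l : I} (h : (l : ℝ) ≤ 1 / 2) : l ⊙ₘ l = 0 :=
  Subtype.ext (by rw [coe_odot]; exact max_eq_right (by linarith))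

theorem homVal_pointHom_le {f g : (contAlg X).carrier}
    (h : ∀ x, homVal (contAlg X) (pointHom x) f ≤ homVal (contAlg X) (pointHom x) g) : f ≤ g := by
  rw [← inf_eq_left]
  refine ContinuousOrderHom.ext fun x => ?_
  have h1 := homVal_inf (pointHom x) f g
  rw [min_eq_left (h x)] at h1
  exact h1

/-- Every homomorphism `φ : C(X) → [0,1]` is the evaluation at a point. Otherwise, by compactness,
there are `G` and `H` in `C(X)` such that `φ G = 0`, `φ H = 1`, and at every point `G > 1/2` or
`H < 1/2`; then `H ⊙ H ≤ G ⊕ G`, which contradicts the values of `φ`. -/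
theorem exists_eq_pointHom (φ : Variety.Hom (contAlg X) algI) : ∃ x, φ = pointHom x := by
  by_contra! hne
  have cont : ∀ f, Continuous fun x : X.carrier => (homVal (contAlg X) (pointHom x) f : ℝ) :=
    fun f => continuous_subtype_val.comp
      (ContinuousOrderHom.continuous_toFun (show X.carrier →Co I from f))
  obtain ⟨G, H, hG, hH, hGH⟩ : ∃ G H, homVal _ φ G = 0 ∧ homVal _ φ H = 1 ∧
      ∀ x ∈ (Set.univ : Set X.carrier), (1 / 2 : ℝ) < homVal _ (pointHom x) G ∨
        (homVal _ (pointHom x) H : ℝ) < 1 / 2 := by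
    refine isCompact_univ.induction_on (p := fun s => ∃ G H, homVal _ φ G = 0 ∧ homVal _ φ H = 1 ∧
      ∀ x ∈ s, (1 / 2 : ℝ) < homVal _ (pointHom x) G ∨
        (homVal _ (pointHom x) H : ℝ) < 1 / 2) ?_ ?_ ?_ ?_
    · exact ⟨MCOps.const 0, MCOps.const 1, homVal_const φ 0, homVal_const φ 1, fun x hx => hx.elim⟩
    · rintro s t hst ⟨G, H, h1, h2, h3⟩
      exact ⟨G, H, h1, h2, fun x hx => h3 x (hst hx)⟩
    · rintro s t ⟨G, H, h1, h2, h3⟩ ⟨G', H', h1', h2', h3'⟩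
      refine ⟨G ⊔ G', H ⊓ H', ?_, ?_, ?_⟩
      · rw [homVal_sup, h1, h1', max_self]
      · rw [homVal_inf, h2, h2', min_self]
      · intro x hx
        have e1 := Subtype.coe_le_coe.mpr
          (monotone_homVal (pointHom x) (le_sup_left (a := G) (b := G')))
        have e2 := Subtype.coe_le_coe.mpr
          (monotone_homVal (pointHom x) (le_sup_right (a := G) (b := G')))
        have e3 := Subtype.coe_le_coe.mpr
          (monotone_homVal (pointHom x) (inf_le_left (a := H) (b := H')))
        have e4 := Subtype.coe_le_coe.mpr
          (monotone_homVal (pointHom x) (inf_le_right (a := H) (b := H')))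
        rcases hx with hx | hx
        · exact (h3 x hx).imp (fun h => h.trans_le e1) fun h => e3.trans_lt h
        · exact (h3' x hx).imp (fun h => h.trans_le e2) fun h => e4.trans_lt h
    · intro x _
      obtain ⟨f, hf⟩ : ∃ f, homVal _ φ f ≠ homVal _ (pointHom x) f := by
        by_contra! hall
        exact hne x (Variety.Hom.ext (funext hall))
      rcases hf.lt_or_gt with h | h
      · obtain ⟨G, h1, h0⟩ := exists_homVal_eq_one_eq_zero h
        have hx : (1 / 2 : ℝ) < homVal _ (pointHom x) G := by rw [h1]; norm_num
        exact ⟨_, mem_nhdsWithin_of_mem_nhds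
          ((isOpen_lt continuous_const (cont G)).mem_nhds hx), G, MCOps.const 1, h0,
          homVal_const φ 1, fun z hz => .inl hz⟩
      · obtain ⟨H, h1, h0⟩ := exists_homVal_eq_one_eq_zero h
        have hx : (homVal _ (pointHom x) H : ℝ) < 1 / 2 := by rw [h0]; norm_num
        exact ⟨_, mem_nhdsWithin_of_mem_nhds
          ((isOpen_lt (cont H) continuous_const).mem_nhds hx), MCOps.const 0, H,
          homVal_const φ 0, h1, fun z hz => .inr hz⟩
  have hle : H ⊙ₘ H ≤ G ⊕ₘ G := by
    refine homVal_pointHom_le fun x => ?_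
    rw [homVal_odot, homVal_oplus]
    rcases hGH x trivial with h | h
    · rw [oplus_self_eq_one h.le]; exact (_ : I).2.2
    · rw [odot_self_eq_zero h.le]; exact (_ : I).2.1
  have hφ := monotone_homVal φ hle
  have h1 : (1 : I) ⊙ₘ 1 = 1 := Subtype.ext (by rw [coe_odot]; norm_num)
  rw [homVal_odot, homVal_oplus, hG, hH, h1, oplus_zero_right] at hφ
  exact hφ.not_gt zero_lt_one

end Points

/-! ### The dual equivalence -/

section Duality

theorem Variety.isIso_of_bijective {S : Signature} {T : Set (Identity S)} {A B : Variety.{u} T}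
    (f : A ⟶ B) (hf : Function.Bijective (show Variety.Hom A B from f).toFun) : IsIso f := by
  let f' : Variety.Hom A B := f
  let e := Equiv.ofBijective f'.toFun hf
  let g : Variety.Hom B A := ⟨e.symm, fun o x => e.injective (by
    have h := f'.map_interp o fun i => e.symm (x i)
    rw [e.apply_symm_apply]
    exact ((congrArg (B.interp o) (funext fun i => e.apply_symm_apply (x i))).symm.trans h.symm))⟩
  exact ⟨g, Variety.Hom.ext (funext e.symm_apply_apply),
    Variety.Hom.ext (funext e.apply_symm_apply)⟩

theorem PosComp.isIso_of_surjective {X Y : PosComp.{u}} (f : X.carrier →Co Y.carrier)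
    (hle : ∀ x y, f x ≤ f y → x ≤ y) (hf : Function.Surjective f) :
    IsIso (show X ⟶ Y from f) := by
  let e := Equiv.ofBijective f
    ⟨fun x y h => le_antisymm (hle x y h.le) (hle y x h.ge), hf⟩
  let g : Y.carrier →Co X.carrier :=
    { toFun := e.symm
      monotone' := fun x y h => hle _ _ (by
        change e _ ≤ e _
        rwa [e.apply_symm_apply, e.apply_symm_apply])
      continuous_toFun := Continuous.continuous_symm_of_equiv_compact_to_t2 (f := e)
        f.continuous_toFun }
  exact ⟨g, ContinuousOrderHom.ext e.symm_apply_apply, ContinuousOrderHom.ext e.apply_symm_apply⟩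

instance (A : Variety.{u} mcInfty) : IsIso (evalElement A) := by
  refine Variety.isIso_of_bijective _ ⟨fun a b h => ?_, fun f => ?_⟩
  · have hab : ∀ x, homVal A x a = homVal A x b := fun x =>
      DFunLike.congr_fun (F := Variety.Hom A algI →Co I) h x
    refine le_antisymm ?_ ?_ <;> by_contra hle <;> obtain ⟨x, hx⟩ := exists_hom_lt hle
    exacts [hx.ne' (hab x), hx.ne (hab x)]
  · let f' : Variety.Hom A algI →Co I := f
    obtain ⟨a, ha⟩ := exists_homVal_eq f'.monotone' f'.continuous_toFun
    exact ⟨a, ContinuousOrderHom.ext (β := I) ha⟩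

instance (X : PosComp.{u}) : IsIso (evalPoint X) := by
  refine PosComp.isIso_of_surjective (Y := maxSpace (contAlg X)) _ (fun x y h => ?_) fun φ => ?_
  · by_contra hle
    obtain ⟨f, hf⟩ := exists_continuousOrderHom_lt hle
    exact hf.not_ge (h f)
  · obtain ⟨x, hx⟩ := exists_eq_pointHom φ
    exact ⟨x, hx.symm⟩

/-- The evaluations at points, as a natural isomorphism of functors on `PosCompᵒᵖ`. -/
noncomputable def evalPointIso :
    𝟭 PosComp.{u}ᵒᵖ ≅ contFunctor.{u} ⋙ maxFunctor.{u}.rightOp :=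
  (NatIso.ofComponents (fun X => (asIso (evalPoint X.unop)).op) fun _ => rfl).symm

/-- The evaluations at elements, as a natural isomorphism of functors on algebras. -/
noncomputable def evalElementIso :
    maxFunctor.{u}.rightOp ⋙ contFunctor.{u} ≅ 𝟭 (Variety.{u} mcInfty) :=
  (NatIso.ofComponents (G := maxFunctor.rightOp ⋙ contFunctor)
    (fun A => (asIso (evalElement A) : A ≅ contFunctor.obj (op (maxFunctor.obj (op A)))))
    fun _ => rfl).symm

theorem evalElementIso_inv_app (A : Variety.{u} mcInfty) :
    evalElementIso.inv.app A = evalElement A := rfl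

/-- The triangle identity. Its form for the evaluations themselves, that `evalElement (C X)`
followed by precomposition with `evalPoint X` is the identity, holds by definition. -/
theorem map_evalPointIso_comp (X : PosComp.{u}ᵒᵖ) :
    contFunctor.map (evalPointIso.hom.app X) ≫ evalElementIso.hom.app (contFunctor.obj X) =
      𝟙 (contFunctor.obj X) := by
  have h1 : contFunctor.map (evalPointIso.inv.app X) ≫
      contFunctor.map (evalPointIso.hom.app X) = 𝟙 _ := by
    rw [← Functor.map_comp, Iso.inv_hom_id_app, CategoryTheory.Functor.map_id]
  have h : contFunctor.map (evalPointIso.hom.app X) =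
      evalElementIso.inv.app (contFunctor.obj X) :=
    calc contFunctor.map (evalPointIso.hom.app X)
      _ = (evalElement (contFunctor.obj X) ≫ contFunctor.map (evalPointIso.inv.app X)) ≫
          contFunctor.map (evalPointIso.hom.app X) := (Category.id_comp _).symm
      _ = evalElement (contFunctor.obj X) ≫ contFunctor.map (evalPointIso.inv.app X) ≫
          contFunctor.map (evalPointIso.hom.app X) := Category.assoc _ _ _
      _ = evalElement (contFunctor.obj X) ≫ 𝟙 _ :=
          congrArg (evalElement (contFunctor.obj X) ≫ ·) h1
      _ = evalElement (contFunctor.obj X) := Category.comp_id _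
  rw [h]
  exact evalElementIso.inv_hom_id_app _

end Duality

end PosCompDual

open PosCompDual
theorem theorem1p1 :
    (∃ (S : Signature) (T : Set (Identity S)),
      Nonempty (PosComp.{u}ᵒᵖ ≌ Variety.{u} T)) ∧
    ∃ (η : 𝟭 PosComp.{u}ᵒᵖ ≅ contFunctor.{u} ⋙ maxFunctor.{u}.rightOp)
      (ε : maxFunctor.{u}.rightOp ⋙ contFunctor.{u} ≅ 𝟭 (Variety.{u} mcInfty)),
      (∀ X : PosComp.{u}, (η.inv.app (op X)).unop = evalPoint X) ∧
      (∀ A : Variety.{u} mcInfty, ε.inv.app A = evalElement A) ∧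
      ∀ X : PosComp.{u}ᵒᵖ,
        contFunctor.map (η.hom.app X) ≫ ε.hom.app (contFunctor.obj X) = 𝟙 (contFunctor.obj X) := by
  exact ⟨⟨mcSignature, mcInfty, ⟨.mk contFunctor maxFunctor.rightOp evalPointIso evalElementIso⟩⟩,
    evalPointIso, evalElementIso, fun _ => rfl, evalElementIso_inv_app, map_evalPointIso_comp⟩
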